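/- A multigraph (loops and multiple edges allowed) is always assumed finite and connected. Each edge (loops included) has two orientations $\epsilon,\epsilon^{-1}$; a path is a nonempty sequence of oriented edges each starting where the previous one ends. Let $\pi:Y\to X$ be a covering map of multigraphs (a covering of one-dimensional CW-complexes), where $X$ has no vertex of valency one. Assume that the cover is Galois, i.e. $G=\mathrm{Aut}(Y/X)$ acts transitively on the fibres of $\pi$, and that $G$ is abelian. Let $\widehat G=\mathrm{Hom}(G,\mathbb{C}^\times)$, with trivial character $\chi_1$, and put $e_\chi=\frac{1}{|G|}\sum_{\sigma\in G}\chi(\sigma)\sigma^{-1}\in\mathbb{C}[G]$ for $\chi\in\widehat G$. A prime path of $X$ is a closed path $\epsilon_1\cdots\epsilon_m$ with $\epsilon_{i+1}\ne\epsilon_i^{-1}$ for $1\le i<m$, with $\epsilon_1\neq\epsilon_m^{-1}$, and which is not of the form $C^a$ with $C$ a closed path and $a\ge2$. A prime $\mathfrak p$ of $X$ is a class of prime paths up to cyclic permutation, and $\nu(\mathfrak p)$ is its length $m$. The Frobenius automorphism $\left(\frac{Y/X}{\mathfrak p}\right)\in G$ is the unique $g\in G$ which maps the initial vertex of a lift to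 $Y$ of a prime path representing $\mathfrak p$ to the terminal vertex of that lift. For $\chi\in\widehat G$ let $$L_{Y/X}(u,\chi)=\prod_{\mathfrak p}\left(1-\chi\left(\left(\tfrac{Y/X}{\mathfrak p}\right)\right)u^{\nu(\mathfrak p)}\right)^{-1}\in\mathbb{C}[[u]],$$ the product being over all primes of $X$. Let $\mathrm{Div}(Y)=\mathbb{Z}[V_Y]$ be the free abelian group on the vertices of $Y$, let $\mathrm{Div}^0(Y)$ be the subgroup of divisors of degree $0$, let $\mathrm{Pr}(Y)$ be the image of the Laplacian $$w_0\mapsto \bigl(d_Y(w_0)-2\cdot\#\{\text{loops at }w_0\}\bigr)w_0-\sum_{w\neq w_0}\#\{\text{edges between }w\text{ and }w_0\}\,w,$$ where $d_Y(w_0)$ is the valency of $w_0$ (loops counted twice), and let $\mathrm{Pic}(Y)=\mathrm{Div}(Y)/\mathrm{Pr}(Y)$ and $\mathrm{Jac}(Y)=\mathrm{Div}^0(Y)/\mathrm{Pr}(Y)$; these are $\mathbb{Z}[G]$-modules. **Theorem.** For every $\chi\in\widehat G$ the product $L_{Y/X}(u,\chi)$ converges in $\mathbb{C}[[u]]$ (coefficientwise)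 and $L_{Y/X}(u,\chi)^{-1}$ is a polynomial in $u$. Let $L^*_{Y/X}(1,\chi)$ be the first nonvanishing Taylor coefficient of this polynomial at $u=1$, and let $$\theta^*_{Y/X}(1)=\sum_{\chi\in\widehat G}L^*_{Y/X}(1,\chi)\,e_{\overline\chi}\in\mathbb{C}[G],\qquad e=1-e_{\chi_1}.$$ Then $\theta^*_{Y/X}(1)\cdot e\in\mathbb{Z}[G]$ and $$\theta^*_{Y/X}(1)\cdot e\in\mathrm{Ann}_{\mathbb{Z}[G]}(\mathrm{Jac}(Y));$$ moreover $\theta^*_{Y/X}(1)\cdot e\in\mathrm{Ann}_{\mathbb{Z}[G]}(\mathrm{Pic}(Y))$. -/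

import Mathlib

open scoped Polynomial PowerSeries

/-- A multigraph (loops and multiple edges allowed), given by its vertices `V` and its *oriented*
edges `E`.  Every edge has exactly two orientations, exchanged by the fixed-point-free involution
`inv`; the (unoriented) edges are the pairs `{e, inv e}`, joining `origin e` and
`origin (inv e)`.  In particular a loop gives two distinct oriented edges. -/
structure Multigraph (V E : Type*) where
  /-- initial vertex of an oriented edge -/
  origin : E → V
  /-- the same edge with the opposite orientation -/
  inv : E → E
  inv_inv : ∀ e, inv (inv e) = e
  inv_ne : ∀ e, inv e ≠ e

namespace Multigraph

section Basic

variable {V E : Type*} (X : Multigraph V E)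

/-- Terminal vertex of an oriented edge. -/
def terminus (e : E) : V := X.origin (X.inv e)

/-- `X` is nonempty and any two vertices are joined by a path (possibly of length zero). -/
def Connected : Prop :=
  Nonempty V ∧ ∀ v w : V,
    Relation.ReflTransGen (fun a b => ∃ e, X.origin e = a ∧ X.terminus e = b) v w

/-- The valency of `v`: the number of edges incident to `v`, a loop being counted twice
(i.e. the number of oriented edges starting at `v`). -/
noncomputable def degree (v : V) : ℕ := Nat.card {e : E // X.origin e = v}

/-- The number of oriented edges from `v` to `w`.  For `v ≠ w` this is the number of edges
connecting `v` and `w`; for `v = w` it is twice the number of loops at `v`. -/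
noncomputable def numEdges (v w : V) : ℕ :=
  Nat.card {e : E // X.origin e = v ∧ X.terminus e = w}

/-! ### Paths and primes -/

/-- A path: a nonempty sequence of oriented edges, each ending where the next one starts. -/
def IsPath (l : List E) : Prop :=
  l ≠ [] ∧ l.IsChain (fun a b => X.terminus a = X.origin b)

/-- A closed path: the terminal vertex is the initial vertex. -/
def IsClosedPath (l : List E) : Prop :=
  X.IsPath l ∧ ∀ a ∈ l.getLast?, ∀ b ∈ l.head?, X.terminus a = X.origin b

/-- Two consecutive oriented edges of `l` are inverse to each other. -/
def HasBacktrack (l : List E) : Prop :=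
  ¬ l.IsChain (fun a b => b ≠ X.inv a)

/-- The first oriented edge of `l` is the inverse of the last one. -/
def HasTail (l : List E) : Prop :=
  ∃ a ∈ l.head?, ∃ b ∈ l.getLast?, a = X.inv b

/-- Prime paths: closed, without backtrack or tail, and not a proper power of a closed path. -/
def IsPrimePath (l : List E) : Prop :=
  X.IsClosedPath l ∧ ¬ X.HasBacktrack l ∧ ¬ X.HasTail l ∧
    ¬ ∃ C : List E, X.IsClosedPath C ∧ ∃ a : ℕ, 2 ≤ a ∧ l = (List.replicate a C).flatten

/-- Two prime paths are equivalent if they differ by a cyclic permutation, i.e. by the choice of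
the starting point. -/
def primeSetoid : Setoid {l : List E // X.IsPrimePath l} where
  r l l' := l.1.IsRotated l'.1
  iseqv := ⟨fun l => List.IsRotated.refl l.1, fun h => h.symm, fun h h' => h.trans h'⟩

/-- The primes of `X`: equivalence classes of prime paths. -/
def Prime : Type _ := Quotient X.primeSetoid

/-- The prime which is the class of a given prime path. -/
def toPrime (l : {l : List E // X.IsPrimePath l}) : X.Prime := Quotient.mk X.primeSetoid l

/-- The length `ν(𝔭)` of a prime. -/
def Prime.length {X : Multigraph V E} (p : X.Prime) : ℕ :=
  Quotient.lift (s := X.primeSetoid) (fun l => l.1.length)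
    (fun l l' (h : l.1.IsRotated l'.1) => h.perm.length_eq) p

/-! ### Divisors -/

/-- The degree of a divisor; `Div(X)` is the free abelian group `V →₀ ℤ`. -/
noncomputable def divDegree (V : Type*) : (V →₀ ℤ) →ₗ[ℤ] ℤ :=
  Finsupp.linearCombination ℤ (fun _ : V => (1 : ℤ))

variable [DecidableEq V]

/-- `ρ_w(v)`, the entry at `(w, v)` of the Laplacian matrix. -/
noncomputable def rho (w v : V) : ℤ :=
  if w = v then (X.degree v : ℤ) - X.numEdges v v else -(X.numEdges w v : ℤ)

/-- The map `div : ℤ^V → Div(X)`, with `χ_v ↦ ∑_w ρ_w(v) · w`. -/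
noncomputable def div [Fintype V] : (V → ℤ) →ₗ[ℤ] (V →₀ ℤ) where
  toFun f := ∑ v, f v • ∑ w, Finsupp.single w (X.rho w v)
  map_add' f g := by simp only [Pi.add_apply, add_smul, Finset.sum_add_distrib]
  map_smul' c f := by
    simp only [Pi.smul_apply, smul_eq_mul, mul_smul, Finset.smul_sum, RingHom.id_apply]

end Basic

/-! ### Covers -/

variable {VX EX VY EY : Type*}

/-- A covering map of multigraphs `Y → X`: a surjective morphism which is bijective on the sets of
oriented edges starting at corresponding vertices. -/
structure Cover (Y : Multigraph VY EY) (X : Multigraph VX EX) where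
  /-- the map on vertices -/
  onV : VY → VX
  /-- the map on oriented edges -/
  onE : EY → EX
  origin_onE : ∀ e, X.origin (onE e) = onV (Y.origin e)
  inv_onE : ∀ e, X.inv (onE e) = onE (Y.inv e)
  surjective : Function.Surjective onV
  lift : ∀ (w : VY) (e : EX), X.origin e = onV w → ∃! e' : EY, Y.origin e' = w ∧ onE e' = e

namespace Cover

variable {X : Multigraph VX EX} {Y : Multigraph VY EY} (π : Cover Y X)

/-- `Aut(Y/X)` as a group of pairs (permutation of the vertices, permutation of the oriented
edges) of `Y`: the automorphisms of `Y` which are compatible with the projection to `X`. -/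
def autSubgroup : Subgroup (Equiv.Perm VY × Equiv.Perm EY) where
  carrier := {g | (∀ e, Y.origin (g.2 e) = g.1 (Y.origin e)) ∧
    (∀ e, Y.inv (g.2 e) = g.2 (Y.inv e)) ∧
    (∀ w, π.onV (g.1 w) = π.onV w) ∧ ∀ e, π.onE (g.2 e) = π.onE e}
  mul_mem' := by
    rintro g h ⟨a, b, c, d⟩ ⟨a', b', c', d'⟩
    refine ⟨fun e => ?_, fun e => ?_, fun e => ?_, fun e => ?_⟩ <;> simp [*]
  one_mem' := by simp
  inv_mem' := by
    rintro g ⟨a, b, c, d⟩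
    refine ⟨fun e => ?_, fun e => ?_, fun w => ?_, fun e => ?_⟩
    · rw [Prod.fst_inv, Prod.snd_inv, Equiv.Perm.eq_inv_iff_eq, ← a]; simp
    · rw [Prod.snd_inv, Equiv.Perm.eq_inv_iff_eq, ← b]; simp
    · rw [Prod.fst_inv, ← c]; simp
    · rw [Prod.snd_inv, ← d]; simp

/-- The automorphism group `Aut(Y/X)` of the cover. -/
abbrev Aut : Type _ := π.autSubgroup

/-- The action of `Aut(Y/X)` on the vertices of `Y`. -/
instance : MulAction π.Aut VY where
  smul g w := g.1.1 w
  one_smul _ := rfl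
  mul_smul _ _ _ := rfl

/-- The cover is Galois (regular): `Aut(Y/X)` acts transitively on every fibre. -/
def IsGalois : Prop := ∀ w w' : VY, π.onV w = π.onV w' → ∃ g : π.Aut, g • w = w'

/-! ### The Artin-Ihara L-functions -/

/-- `g` is a Frobenius automorphism of the prime `p` of `X`: for some prime path representing `p`
and some lift `P` of it to `Y`, `g` maps the initial vertex of `P` to its terminal vertex. -/
def IsFrobenius (p : X.Prime) (g : π.Aut) : Prop :=
  ∃ (l : {l : List EX // X.IsPrimePath l}) (P : List EY),
    X.toPrime l = p ∧ Y.IsPath P ∧ P.map π.onE = l.1 ∧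
      ∃ a ∈ P.head?, ∃ b ∈ P.getLast?, g • Y.origin a = Y.terminus b

open Classical in
/-- The Frobenius automorphism of `p`.  For a cover with `Y` connected, Galois with abelian group,
it exists and is unique. -/
noncomputable def frob (p : X.Prime) : π.Aut :=
  if h : ∃ g, π.IsFrobenius p g then h.choose else 1

/-- The Euler factor of `L_{Y/X}(u, χ)` at the prime `p`, as a formal power series in `u`. -/
noncomputable def eulerFactor (χ : π.Aut →* ℂˣ) (p : X.Prime) : ℂ⟦X⟧ :=
  (1 - PowerSeries.C (χ (π.frob p) : ℂ) * PowerSeries.X ^ p.length)⁻¹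

open scoped PowerSeries.WithPiTopology in
/-- The formal infinite product `L_{Y/X}(u, χ)` converges (coefficientwise). -/
def LConverges (χ : π.Aut →* ℂˣ) : Prop := Multipliable (π.eulerFactor χ)

open scoped PowerSeries.WithPiTopology in
/-- The Artin-Ihara `L`-function `L_{Y/X}(u, χ)`, the formal infinite product of the Euler
factors over all primes of `X`. -/
noncomputable def L (χ : π.Aut →* ℂˣ) : ℂ⟦X⟧ := ∏' p : X.Prime, π.eulerFactor χ p

/-- The idempotent `e_χ = |G|⁻¹ ∑ χ(σ) σ⁻¹` of `ℂ[G]`, with `G = Aut(Y/X)`. -/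
noncomputable def idem (χ : π.Aut →* ℂ) : MonoidAlgebra ℂ π.Aut :=
  (Nat.card π.Aut : ℂ)⁻¹ • ∑ᶠ σ : π.Aut, MonoidAlgebra.single σ⁻¹ (χ σ)

/-- The complex conjugate of a character, as a `ℂ`-valued function. -/
noncomputable def conjChar (χ : π.Aut →* ℂˣ) : π.Aut →* ℂ :=
  ((starRingEnd ℂ : ℂ →+* ℂ) : ℂ →* ℂ).comp ((Units.coeHom ℂ).comp χ)

/-- The first nonvanishing Taylor coefficient of a polynomial at `u = 1`. -/
noncomputable def leadingCoeffAtOne (P : ℂ[X]) : ℂ := (Polynomial.taylor 1 P).trailingCoeff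

/-- The special value `θ*(1) = ∑_χ L*(1, χ) e_{conj χ}`, where `L*(1, χ)` is the first nonvanishing
Taylor coefficient at `u = 1` of `Linv χ`, the polynomial `L_{Y/X}(u, χ)⁻¹`. -/
noncomputable def thetaStar (Linv : (π.Aut →* ℂˣ) → ℂ[X]) : MonoidAlgebra ℂ π.Aut :=
  ∑ᶠ χ : π.Aut →* ℂˣ, leadingCoeffAtOne (Linv χ) • π.idem (π.conjChar χ)

/-! ### The Picard group and the Jacobian of `Y` as `ℤ[G]`-modules -/

/-- `Div(Y)` as a representation of `Aut(Y/X)`: `g` maps the divisor `w` to `g • w`. -/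
noncomputable def divRep : Representation ℤ π.Aut (VY →₀ ℤ) where
  toFun g := Finsupp.lmapDomain ℤ ℤ (fun w => g • w)
  map_one' := by ext; simp
  map_mul' g h := by ext; simp [mul_smul]

/-- `Div(Y)` as a `ℤ[G]`-module. -/
abbrev DivMod : Type _ := π.divRep.asModule

theorem divDegree_divRep (g : π.Aut) (D : VY →₀ ℤ) :
    divDegree VY (π.divRep g D) = divDegree VY D := by
  have h : (divDegree VY).comp (π.divRep g) = divDegree VY := by
    ext w; simp [divDegree, divRep]
  exact LinearMap.congr_fun h D

theorem numEdges_smul (g : π.Aut) (v w : VY) : Y.numEdges (g • v) (g • w) = Y.numEdges v w := by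
  obtain ⟨h1, h2, -, -⟩ := g.2
  refine (Nat.card_congr (g.1.2.subtypeEquiv fun e => ?_)).symm
  have a : ∀ x y : VY, g.1.1 x = g • y ↔ x = y := fun x y => g.1.1.injective.eq_iff
  simp only [terminus, h2, h1, a]

theorem degree_smul (g : π.Aut) (v : VY) : Y.degree (g • v) = Y.degree v := by
  obtain ⟨h1, -, -, -⟩ := g.2
  refine (Nat.card_congr (g.1.2.subtypeEquiv fun e => ?_)).symm
  have a : ∀ x y : VY, g.1.1 x = g • y ↔ x = y := fun x y => g.1.1.injective.eq_iff
  simp only [h1, a]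

/-- `Div⁰(Y)`, the divisors of degree zero, as a `ℤ[G]`-submodule of `Div(Y)`. -/
noncomputable def divZero : Submodule (MonoidAlgebra ℤ π.Aut) π.DivMod :=
  MonoidAlgebra.submoduleOfSMulMem
    ((LinearMap.ker (divDegree VY)).comap π.divRep.asModuleEquiv.toLinearMap) (by
      intro g v hv
      have h : π.divRep.asModuleEquiv (MonoidAlgebra.of ℤ π.Aut g • v) =
          π.divRep g (π.divRep.asModuleEquiv v) := by
        rw [Representation.asModuleEquiv_map_smul, Representation.asAlgebraHom_of]
      rw [Submodule.mem_comap, LinearMap.mem_ker] at hv ⊢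
      exact (congrArg _ h).trans ((π.divDegree_divRep g _).trans hv))

variable [DecidableEq VY]

theorem rho_smul (g : π.Aut) (w v : VY) : Y.rho (g • w) (g • v) = Y.rho w v := by
  simp [rho, numEdges_smul, degree_smul]

variable [Fintype VY]

theorem divRep_div (g : π.Aut) (f : VY → ℤ) :
    π.divRep g (Y.div f) = Y.div fun v => f (g⁻¹ • v) := by
  simp only [div, LinearMap.coe_mk, AddHom.coe_mk, map_sum, map_smul]
  refine Eq.trans ?_ (Equiv.sum_comp (MulAction.toPerm g)
    fun v => f (g⁻¹ • v) • ∑ w, Finsupp.single w (Y.rho w v))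
  refine Finset.sum_congr rfl fun v _ => ?_
  rw [MulAction.toPerm_apply, inv_smul_smul]
  congr 1
  refine Eq.trans ?_ (Equiv.sum_comp (MulAction.toPerm g) fun w => Finsupp.single w (Y.rho w (g • v)))
  refine Finset.sum_congr rfl fun w _ => ?_
  simp [divRep, rho_smul]

/-- `Pr(Y)`, the image of `div`, as a `ℤ[G]`-submodule of `Div(Y)`. -/
noncomputable def principal : Submodule (MonoidAlgebra ℤ π.Aut) π.DivMod :=
  MonoidAlgebra.submoduleOfSMulMem
    ((LinearMap.range Y.div).comap π.divRep.asModuleEquiv.toLinearMap) (by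
      rintro g v ⟨f, hf⟩
      refine ⟨fun v => f (g⁻¹ • v), ?_⟩
      rw [← divRep_div, hf]
      exact ((Representation.asModuleEquiv_map_smul _ _ _).trans
        (by rw [Representation.asAlgebraHom_of]; rfl)).symm)

/-- `Pic(Y) = Div(Y)/Pr(Y)` as a `ℤ[G]`-module. -/
abbrev Pic : Type _ := π.DivMod ⧸ π.principal

/-- `Jac(Y) = Div⁰(Y)/Pr(Y)` as a `ℤ[G]`-module. -/
abbrev Jac : Type _ := π.divZero ⧸ π.principal.submoduleOf π.divZero

end Cover

end Multigraph

/-!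
The cover is trivialized by a *voltage*: a section `VX → VY` and the free action of
`G = Aut(Y/X)` on `VY` turn every oriented edge `e` of `X` into an element `τ(e) ∈ G`, with
`τ(e⁻¹) = τ(e)⁻¹`, and the Frobenius automorphism of a prime is the product of the `τ(e)` along it
(`Multigraph.Cover.Voltage.character_frob`).

*The `L`-function is the inverse of a polynomial.* Let `W` be the matrix indexed by oriented edges
with `W a b = χ(τ(a))` when `b` may follow `a` without backtracking, and `0` otherwise. A cyclic
word without backtracking is in exactly one way a rotated power of a prime, which expresses
`tr (W ^ m)` as a sum over primes of length dividing `m`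
(`Multigraph.trace_edgeMatrix_pow`). By Jacobi's formula for the derivative of a determinant these
traces are the coefficients of the logarithmic derivative of `det (1 - uW)⁻¹`, and the sums over
primes are those of the Euler product, up to any given degree and for any large enough finite set
of primes. A power series is determined by its logarithmic derivative and constant coefficient,
hence the product converges coefficientwise to `det (1 - uW)⁻¹`
(`hasProd_eulerFactor_charpolyRev_inv`).

*The special value.* The Ihara–Bass formula (`Multigraph.ihara_bass`) turns `det (1 - uW)` into
`(1 - u²) ^ k * H(u)`, where `k` is the number of edges minus the number of vertices of `X` and
`H(1)` is the determinant of the Laplacian `Δ_χ` of `X` twisted by `χ ∘ τ`. For `χ ≠ 1` this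
determinant is nonzero, because a function killed by `Δ_χ` has energy zero and so lifts to a
constant function on the connected multigraph `Y`. Hence `L*(1, χ) = (-2) ^ k * det Δ_χ`.

*Annihilation.* Let `Δ` be the Laplacian of `X` with entries in `ℤ[G]`, twisted by `τ`. Its
determinant is sent to `det Δ_χ` by `χ`, its value at `χ⁻¹` is the same since `Δ_{χ⁻¹}` is the
transpose of `Δ_χ`, and its value at the trivial character is `0`. By Fourier inversion,
`θ*(1) · e = (-2) ^ k * det Δ`. The rows of `Δ` express the divisors `div(s(v))` in terms of
the generators `s(w)` of the `ℤ[G]`-module `Div(Y)`, so multiplying by the adjugate shows that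
`det Δ` maps `Div(Y)` into `Pr(Y)`.

The hypothesis on valencies ensures `k ≥ 0`, unless `X` is a point, in which case `G` is trivial.
-/

/-! ### Derivative of a determinant and powers of a matrix -/

theorem Derivation.leibniz_finsetProd {R A ι : Type*} [CommRing R] [CommRing A] [Algebra R A]
    [DecidableEq ι] (d : Derivation R A A) (s : Finset ι) (f : ι → A) :
    d (∏ i ∈ s, f i) = ∑ i ∈ s, (∏ j ∈ s.erase i, f j) * d (f i) := by
  induction s using Finset.induction_on with
  | empty => simp
  | insert a s ha ih =>
    rw [Finset.prod_insert ha, Derivation.leibniz, ih, Finset.sum_insert ha,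
      Finset.erase_insert ha, smul_eq_mul, smul_eq_mul, add_comm, Finset.mul_sum]
    congr 1
    refine Finset.sum_congr rfl fun i hi => ?_
    rw [Finset.erase_insert_of_ne (by rintro rfl; exact ha hi),
      Finset.prod_insert (fun h => ha (Finset.mem_of_mem_erase h)), mul_assoc]

/-- Jacobi's formula for the derivative of a determinant. -/
theorem Derivation.map_det {R A n : Type*} [CommRing R] [CommRing A] [Algebra R A]
    [Fintype n] [DecidableEq n] (d : Derivation R A A) (M : Matrix n n A) :
    d M.det = (M.adjugate * M.map d).trace := by
  have h : ∀ j, (M.adjugate * M.map d) j j = (M.updateCol j (fun i => d (M i j))).det := by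
    intro j
    rw [← Matrix.cramer_apply, Matrix.cramer_eq_adjugate_mulVec]
    rfl
  simp only [Matrix.trace, Matrix.diag, h]
  simp only [Matrix.det_apply, map_sum, Units.smul_def, map_zsmul, d.leibniz_finsetProd]
  rw [Finset.sum_comm]
  refine Finset.sum_congr rfl fun σ _ => ?_
  rw [← Finset.smul_sum]
  congr 1
  refine Finset.sum_congr rfl fun j _ => ?_
  rw [← Finset.mul_prod_erase _ _ (Finset.mem_univ j), Matrix.updateCol_self, mul_comm]
  congr 1
  refine Finset.prod_congr rfl fun i hi => ?_
  rw [Matrix.updateCol_ne (Finset.ne_of_mem_erase hi)]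

theorem Matrix.pow_apply_eq_sum_paths {n R : Type*} [CommRing R] [Fintype n] [DecidableEq n]
    (W : Matrix n n R) (m : ℕ) (a b : n) :
    (W ^ m) a b = ∑ g : Fin (m + 1) → n,
      if g 0 = a ∧ g (Fin.last m) = b then ∏ i : Fin m, W (g i.castSucc) (g i.succ) else 0 := by
  induction m generalizing a with
  | zero =>
    rw [← (Equiv.funUnique (Fin 1) n).symm.sum_comp, pow_zero, Matrix.one_apply,
      Finset.sum_eq_single a]
    · simp [Equiv.funUnique]
    · intro x _ hx
      simp [Equiv.funUnique, hx]
    · simp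
  | succ m ih =>
    symm
    rw [pow_succ', Matrix.mul_apply, ← (Fin.consEquiv fun _ => n).sum_comp, Fintype.sum_prod_type,
      Finset.sum_eq_single a]
    · simp_rw [ih, Finset.mul_sum]
      rw [Finset.sum_comm]
      refine Finset.sum_congr rfl fun g _ => ?_
      rw [Finset.sum_eq_single (g 0)]
      · rw [Fin.prod_univ_succ]
        simp [Fin.consEquiv, ← Fin.succ_last]
      · intro x _ hx
        simp [hx.symm]
      · simp
    · intro x _ hx
      simp [Fin.consEquiv, hx]
    · simp

/-- `tr (W ^ m)` is the sum of the weights of the closed sequences `g 0, …, g m = g 0`. -/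
theorem Matrix.trace_pow_eq_sum_closed_paths {n R : Type*} [CommRing R] [Fintype n] [DecidableEq n]
    (W : Matrix n n R) (m : ℕ) :
    (W ^ m).trace = ∑ g : Fin (m + 1) → n,
      if g (Fin.last m) = g 0 then ∏ i : Fin m, W (g i.castSucc) (g i.succ) else 0 := by
  simp only [Matrix.trace, Matrix.diag, W.pow_apply_eq_sum_paths]
  rw [Finset.sum_comm]
  refine Finset.sum_congr rfl fun g _ => ?_
  rw [Finset.sum_eq_single (g 0)]
  · simp
  · intro x _ hx
    simp [hx.symm]
  · simp

/-- Up to degree `n`, a power series is determined by its constant coefficient and by the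
coefficients of degree `< n` of its logarithmic derivative. -/
theorem PowerSeries.coeff_eq_of_derivative_eq_mul {K : Type*} [Field K] [CharZero K]
    {f₁ f₂ g₁ g₂ : K⟦X⟧} (h₁ : PowerSeries.derivative K f₁ = f₁ * g₁)
    (h₂ : PowerSeries.derivative K f₂ = f₂ * g₂)
    (h₀ : PowerSeries.constantCoeff f₁ = PowerSeries.constantCoeff f₂) {n : ℕ}
    (hg : ∀ k < n, PowerSeries.coeff k g₁ = PowerSeries.coeff k g₂) :
    PowerSeries.coeff n f₁ = PowerSeries.coeff n f₂ := by
  suffices ∀ m ≤ n, PowerSeries.coeff m f₁ = PowerSeries.coeff m f₂ from this n le_rfl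
  intro m
  induction m using Nat.strong_induction_on with
  | _ m ih =>
    intro hm
    rcases m with _ | m
    · simpa using h₀
    · have e₁ := congrArg (PowerSeries.coeff m) h₁
      have e₂ := congrArg (PowerSeries.coeff m) h₂
      rw [PowerSeries.coeff_derivative, PowerSeries.coeff_mul] at e₁ e₂
      have : PowerSeries.coeff (m + 1) f₁ * ((m : K) + 1) =
          PowerSeries.coeff (m + 1) f₂ * ((m : K) + 1) := by
        rw [e₁, e₂]
        refine Finset.sum_congr rfl fun p hp => ?_
        have := Finset.HasAntidiagonal.mem_antidiagonal.1 hp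
        rw [ih p.1 (by omega) (by omega), hg p.2 (by omega)]
      exact mul_right_cancel₀ (Nat.cast_add_one_ne_zero m) this

/-! ### Euler factors and the reciprocal characteristic polynomial -/

/-- The logarithmic derivative of an Euler factor. -/
theorem derivative_eulerFactor {K : Type*} [Field K] (c : K) {ν : ℕ} (hν : 0 < ν) :
    PowerSeries.derivative K (1 - PowerSeries.C c * PowerSeries.X ^ ν : K⟦X⟧)⁻¹ =
      (1 - PowerSeries.C c * PowerSeries.X ^ ν : K⟦X⟧)⁻¹ *
        PowerSeries.mk fun k => if ν ∣ k + 1 then (ν : K) * c ^ ((k + 1) / ν) else 0 := by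
  set f : K⟦X⟧ := 1 - PowerSeries.C c * PowerSeries.X ^ ν with hf
  set g : K⟦X⟧ := PowerSeries.mk fun k => if ν ∣ k + 1 then (ν : K) * c ^ ((k + 1) / ν) else 0
    with hg
  have hf0 : PowerSeries.constantCoeff f ≠ 0 := by simp [hf, hν.ne']
  have hdf : PowerSeries.derivative K f = -(f * g) := by
    have e : f * g = PowerSeries.C (ν * c) * PowerSeries.X ^ (ν - 1) := by
      ext k
      rw [hf, sub_mul, one_mul, map_sub, mul_assoc, PowerSeries.coeff_C_mul,
        PowerSeries.coeff_X_pow_mul', PowerSeries.coeff_C_mul, PowerSeries.coeff_X_pow, hg,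
        PowerSeries.coeff_mk, PowerSeries.coeff_mk]
      rcases lt_trichotomy (k + 1) ν with h | h | h
      · rw [if_neg (fun h' => by have := Nat.le_of_dvd (by omega) h'; omega), if_neg (by omega),
          if_neg (by omega)]
        simp
      · subst h
        simp
      · rw [if_pos (by omega : ν ≤ k), if_neg (by omega : ¬ k = ν - 1)]
        have e : k + 1 = (k - ν + 1) + ν := by omega
        simp only [e, Nat.dvd_add_self_right, Nat.add_div_right _ hν]
        split_ifs <;> ring
    rw [e, hf]
    simp [Derivation.leibniz, Derivation.leibniz_pow]
    ring
  rw [PowerSeries.derivative_inv', hdf]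
  have := PowerSeries.inv_mul_cancel f hf0
  linear_combination (f⁻¹ * g) * this

open Polynomial in
/-- The logarithmic derivative of `det (1 - uW)⁻¹` is `∑ tr (W ^ (k + 1)) u ^ k`. -/
theorem Matrix.derivative_charpolyRev_inv {K n : Type*} [Field K] [Fintype n] [DecidableEq n]
    (W : Matrix n n K) :
    PowerSeries.derivative K ((W.charpolyRev : K[X]) : K⟦X⟧)⁻¹ =
      ((W.charpolyRev : K[X]) : K⟦X⟧)⁻¹ * PowerSeries.mk fun k => (W ^ (k + 1)).trace := by
  set D : K⟦X⟧ := ((W.charpolyRev : K[X]) : K⟦X⟧) with hD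
  have hD0 : PowerSeries.constantCoeff D ≠ 0 := by
    simp [hD, Polynomial.coeff_zero_eq_eval_zero]
  let M : Matrix n n K⟦X⟧ := 1 - (PowerSeries.X : K⟦X⟧) • W.map PowerSeries.C
  have hDM : D = M.det := by
    rw [hD, Matrix.charpolyRev, ← Polynomial.coeToPowerSeries.ringHom_apply, RingHom.map_det]
    congr 1
    ext i j : 1
    by_cases h : i = j <;> simp [M, h] <;> exact mul_comm _ _
  -- The geometric series `∑ Wᵏ uᵏ`, the inverse of `M`.
  let T : Matrix n n K⟦X⟧ := Matrix.of fun i j => PowerSeries.mk fun k => (W ^ k) i j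
  have hT : T * W.map PowerSeries.C = Matrix.of fun i j =>
      PowerSeries.mk fun k => (W ^ (k + 1)) i j := by
    ext i j k
    simp [T, Matrix.mul_apply, pow_succ, PowerSeries.coeff_mul_C]
  have hTM : M * T = 1 := by
    have : M * T = T - (PowerSeries.X : K⟦X⟧) • (W.map PowerSeries.C * T) := by
      simp [M, sub_mul]
    rw [this]
    ext i j k
    have e : (W.map PowerSeries.C * T) i j = PowerSeries.mk fun k => (W ^ (k + 1)) i j := by
      ext k
      simp [T, Matrix.mul_apply, pow_succ', PowerSeries.coeff_C_mul]
    rw [Matrix.sub_apply, Matrix.smul_apply, e, smul_eq_mul]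
    rcases k with _ | k
    · by_cases h : i = j <;> simp [T, h, Matrix.one_apply]
    · by_cases h : i = j <;> simp [T, h, Matrix.one_apply, PowerSeries.coeff_succ_X_mul]
  have hadj : M.adjugate = D • T := by
    calc M.adjugate = M.adjugate * (M * T) := by rw [hTM, mul_one]
      _ = D • T := by rw [← mul_assoc, Matrix.adjugate_mul, hDM]; simp
  have hdM : M.map (PowerSeries.derivative K) = -W.map PowerSeries.C := by
    ext i j : 1
    by_cases h : i = j <;> simp [M, h, Derivation.leibniz]
  have hdD : PowerSeries.derivative K D = -(D * PowerSeries.mk fun k => (W ^ (k + 1)).trace) := by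
    rw [hDM, Derivation.map_det, hdM, hadj, ← hDM, Matrix.mul_neg, Matrix.trace_neg,
      Matrix.smul_mul, Matrix.trace_smul, hT, smul_eq_mul]
    congr 2
    ext k
    simp [Matrix.trace]
  rw [PowerSeries.derivative_inv', hdD]
  have := PowerSeries.inv_mul_cancel D hD0
  linear_combination (D⁻¹ * PowerSeries.mk fun k => (W ^ (k + 1)).trace) * this

open scoped PowerSeries.WithPiTopology in
/-- If the traces of the powers of `W` are the power sums attached to a family of Euler factors,
then the Euler product converges coefficientwise to `det (1 - uW)⁻¹`: the coefficient of degree `d`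
of a finite partial product is the expected one as soon as the product contains all factors
with `ν p ≤ d`. -/
theorem hasProd_eulerFactor_charpolyRev_inv {ι K n : Type*} [Field K] [CharZero K]
    [TopologicalSpace K] [Fintype n] [DecidableEq n] (W : Matrix n n K) (c : ι → K) (ν : ι → ℕ)
    (hν : ∀ p, 0 < ν p) (hfin : ∀ m, {p | ν p ≤ m}.Finite)
    (htr : ∀ (m : ℕ) (s : Finset ι), 0 < m → (∀ p, ν p ≤ m → p ∈ s) →
      (W ^ m).trace = ∑ p ∈ s with ν p ∣ m, (ν p : K) * c p ^ (m / ν p)) :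
    HasProd (fun p => (1 - PowerSeries.C (c p) * PowerSeries.X ^ ν p : K⟦X⟧)⁻¹)
      ((W.charpolyRev : K[X]) : K⟦X⟧)⁻¹ := by
  rw [HasProd, PowerSeries.WithPiTopology.tendsto_iff_coeff_tendsto]
  intro d
  refine tendsto_const_nhds.congr' ?_
  rw [SummationFilter.unconditional_filter]
  filter_upwards [Filter.eventually_ge_atTop (hfin d).toFinset] with s hs
  refine PowerSeries.coeff_eq_of_derivative_eq_mul W.derivative_charpolyRev_inv
    (g₂ := ∑ p ∈ s, PowerSeries.mk fun k =>
      if ν p ∣ k + 1 then (ν p : K) * c p ^ ((k + 1) / ν p) else 0) ?_ ?_ ?_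
  · classical
    rw [Derivation.leibniz_finsetProd, Finset.mul_sum]
    refine Finset.sum_congr rfl fun p hp => ?_
    rw [derivative_eulerFactor _ (hν p), ← mul_assoc, mul_comm (∏ j ∈ _, _),
      Finset.mul_prod_erase s (fun p => (1 - PowerSeries.C (c p) * PowerSeries.X ^ ν p : K⟦X⟧)⁻¹) hp]
  · rw [map_prod, Finset.prod_eq_one]
    · simp [Polynomial.coeff_zero_eq_eval_zero]
    · intro p _
      simp [(hν p).ne']
  · intro k hk
    rw [PowerSeries.coeff_mk, htr (k + 1) s (by omega), Finset.sum_filter, map_sum]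
    · simp
    · intro p hp
      exact hs (by simp; omega)

/-! ### Fourier inversion in the group algebra -/

theorem finite_monoidHom_complexUnits {G : Type*} [Group G] [Finite G]
    (hab : ∀ g h : G, g * h = h * g) : Finite (G →* ℂˣ) := by
  let _ : CommGroup G := { ‹Group G› with mul_comm := hab }
  exact Finite.of_equiv _ (CommGroup.monoidHom_mulEquiv_of_hasEnoughRootsOfUnity G ℂ).some.symm.toEquiv

theorem finsum_monoidHom_apply {G : Type*} [Group G] [Finite G] [DecidableEq G]
    (hab : ∀ g h : G, g * h = h * g) (σ : G) :
    ∑ᶠ χ : G →* ℂˣ, (χ σ : ℂ) = if σ = 1 then (Nat.card G : ℂ) else 0 := by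
  have := finite_monoidHom_complexUnits hab
  have := Fintype.ofFinite (G →* ℂˣ)
  let _ : CommGroup G := { ‹Group G› with mul_comm := hab }
  rw [finsum_eq_sum_of_fintype]
  split_ifs with h
  · subst h
    have e : Nat.card (G →* ℂˣ) = Nat.card G :=
      CommGroup.card_monoidHom_of_hasEnoughRootsOfUnity G ℂ
    rw [← e]
    simp
  · obtain ⟨ψ, hψ⟩ := CommGroup.exists_apply_ne_one_of_hasEnoughRootsOfUnity G ℂ h
    have e := Equiv.sum_comp (Equiv.mulLeft ψ) fun χ : G →* ℂˣ => (χ σ : ℂ)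
    simp only [Equiv.coe_mulLeft, MonoidHom.mul_apply, Units.val_mul, ← Finset.mul_sum] at e
    by_contra h0
    exact hψ (Units.ext (by simpa [h0] using e))

theorem sum_apply_eq_zero_of_ne_one {G : Type*} [Group G] [Fintype G] {χ : G →* ℂˣ} (hχ : χ ≠ 1) :
    ∑ σ : G, (χ σ : ℂ) = 0 := by
  obtain ⟨g, hg⟩ : ∃ g, χ g ≠ 1 := by
    by_contra! h
    exact hχ (MonoidHom.ext h)
  have e := Equiv.sum_comp (Equiv.mulLeft g) fun σ : G => (χ σ : ℂ)
  simp only [Equiv.coe_mulLeft, map_mul, Units.val_mul, ← Finset.mul_sum] at e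
  by_contra h0
  exact hg (Units.ext (by simpa [h0] using e))

theorem star_character_apply {G : Type*} [Group G] [Finite G] (χ : G →* ℂˣ) (σ : G) :
    starRingEnd ℂ (χ σ : ℂ) = (χ⁻¹ σ : ℂˣ) := by
  have h : ‖(χ σ : ℂ)‖ = 1 := by
    refine Complex.norm_eq_one_of_pow_eq_one (n := Nat.card G) ?_ Nat.card_pos.ne'
    rw [← Units.val_pow_eq_pow_val, ← map_pow, pow_card_eq_one', map_one, Units.val_one]
  rw [MonoidHom.inv_apply, Units.val_inv_eq_inv_val, Complex.inv_def, Complex.normSq_eq_norm_sq, h]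
  simp

/-- The idempotent `e_χ = |G|⁻¹ ∑ χ(σ) σ⁻¹` of `ℂ[G]`, for an arbitrary group `G`. -/
noncomputable def charIdem {G : Type*} [Group G] (χ : G →* ℂ) : MonoidAlgebra ℂ G :=
  (Nat.card G : ℂ)⁻¹ • ∑ᶠ σ : G, MonoidAlgebra.single σ⁻¹ (χ σ)

/-- `Z e_χ = χ(Z) e_χ` for `Z ∈ ℂ[G]`. -/
theorem mul_charIdem {G : Type*} [Group G] [Finite G] (hab : ∀ g h : G, g * h = h * g)
    (χ : G →* ℂˣ) (Z : MonoidAlgebra ℂ G) :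
    Z * charIdem ((Units.coeHom ℂ).comp χ) =
      MonoidAlgebra.lift ℂ ℂ G ((Units.coeHom ℂ).comp χ) Z • charIdem ((Units.coeHom ℂ).comp χ) := by
  have := Fintype.ofFinite G
  induction Z using MonoidAlgebra.induction_linear with
  | zero => simp
  | add x y hx hy => rw [add_mul, hx, hy, map_add, add_smul]
  | single τ c =>
    rw [charIdem, mul_smul_comm, smul_comm, finsum_eq_sum_of_fintype, Finset.mul_sum]
    congr 1
    rw [Finset.smul_sum, ← Equiv.sum_comp (Equiv.mulLeft τ)
        fun σ => MonoidAlgebra.single τ c * MonoidAlgebra.single σ⁻¹ (((Units.coeHom ℂ).comp χ) σ)]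
    refine Finset.sum_congr rfl fun σ _ => ?_
    rw [MonoidAlgebra.single_mul_single]
    simp [MonoidAlgebra.lift_single, hab τ σ, mul_assoc, mul_comm (χ τ : ℂ)]

theorem finsum_charIdem {G : Type*} [Group G] [Finite G] (hab : ∀ g h : G, g * h = h * g) :
    ∑ᶠ χ : G →* ℂˣ, charIdem ((Units.coeHom ℂ).comp χ) = 1 := by
  classical
  have := Fintype.ofFinite G
  have := finite_monoidHom_complexUnits hab
  have := Fintype.ofFinite (G →* ℂˣ)
  rw [finsum_eq_sum_of_fintype]
  simp only [charIdem, finsum_eq_sum_of_fintype, ← Finset.smul_sum]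
  rw [Finset.sum_comm]
  have h : ∀ σ : G, ∑ χ : G →* ℂˣ, MonoidAlgebra.single σ⁻¹ (((Units.coeHom ℂ).comp χ) σ) =
      if σ = 1 then (Nat.card G : ℂ) • (1 : MonoidAlgebra ℂ G) else 0 := by
    intro σ
    have hs : MonoidAlgebra.single σ⁻¹ (∑ χ : G →* ℂˣ, ((Units.coeHom ℂ).comp χ) σ) =
        ∑ χ : G →* ℂˣ, MonoidAlgebra.single σ⁻¹ (((Units.coeHom ℂ).comp χ) σ) :=
      map_sum (MonoidAlgebra.singleAddHom σ⁻¹) _ _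
    have := finsum_monoidHom_apply hab σ
    rw [finsum_eq_sum_of_fintype] at this
    rw [← hs]
    simp only [MonoidHom.comp_apply, Units.coeHom_apply, this]
    split_ifs with h
    · simp [h, MonoidAlgebra.one_def]
    · simp
  simp only [h, Finset.sum_ite_eq', Finset.mem_univ, if_true]
  rw [smul_smul, inv_mul_cancel₀, one_smul]
  exact_mod_cast Nat.card_pos.ne'

open Classical in
theorem charIdem_mul_charIdem_one {G : Type*} [Group G] [Finite G]
    (hab : ∀ g h : G, g * h = h * g) (χ : G →* ℂˣ) :
    charIdem ((Units.coeHom ℂ).comp χ) * charIdem (1 : G →* ℂ) =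
      if χ = 1 then charIdem (1 : G →* ℂ) else 0 := by
  classical
  have := Fintype.ofFinite G
  have h := mul_charIdem hab (1 : G →* ℂˣ) (charIdem ((Units.coeHom ℂ).comp χ))
  have e1 : (Units.coeHom ℂ).comp (1 : G →* ℂˣ) = 1 := by ext; simp
  rw [e1] at h
  have e2 : MonoidAlgebra.lift ℂ ℂ G (1 : G →* ℂ) (charIdem ((Units.coeHom ℂ).comp χ)) =
      if χ = 1 then 1 else 0 := by
    rw [charIdem, map_smul, finsum_eq_sum_of_fintype, map_sum]
    simp only [MonoidAlgebra.lift_single, MonoidHom.one_apply, smul_eq_mul, mul_one,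
      MonoidHom.comp_apply, Units.coeHom_apply]
    split_ifs with h
    · subst h
      simp
    · rw [sum_apply_eq_zero_of_ne_one h, mul_zero]
  rw [h, e2]
  split_ifs <;> simp only [one_smul, zero_smul]

/-- Fourier inversion for an element `Z` of `ℂ[G]` which vanishes at the trivial character. The
value `a 1` is arbitrary, since the factor `1 - e_1` removes it. -/
theorem eq_finsum_charIdem_mul {G : Type*} [Group G] [Finite G]
    (hab : ∀ g h : G, g * h = h * g) (Z : MonoidAlgebra ℂ G) (a : (G →* ℂˣ) → ℂ)
    (h1 : MonoidAlgebra.lift ℂ ℂ G (1 : G →* ℂ) Z = 0)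
    (ha : ∀ χ : G →* ℂˣ, χ ≠ 1 →
      MonoidAlgebra.lift ℂ ℂ G ((Units.coeHom ℂ).comp χ⁻¹) Z = a χ) :
    Z = (∑ᶠ χ : G →* ℂˣ, a χ • charIdem ((Units.coeHom ℂ).comp χ⁻¹)) *
      (1 - charIdem (1 : G →* ℂ)) := by
  classical
  have := finite_monoidHom_complexUnits hab
  have := Fintype.ofFinite (G →* ℂˣ)
  have e1 : (Units.coeHom ℂ).comp (1 : G →* ℂˣ) = 1 := by ext; simp
  conv_lhs => rw [← mul_one Z, ← finsum_charIdem hab]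
  rw [finsum_eq_sum_of_fintype, finsum_eq_sum_of_fintype, Finset.mul_sum, Finset.sum_mul,
    ← Equiv.sum_comp (Equiv.inv (G →* ℂˣ))]
  refine Finset.sum_congr rfl fun χ _ => ?_
  rw [Equiv.inv_apply, mul_charIdem hab, smul_mul_assoc, mul_sub, mul_one,
    charIdem_mul_charIdem_one hab]
  by_cases hχ : χ = 1
  · subst hχ
    have i1 : (1 : G →* ℂˣ)⁻¹ = 1 := by ext; simp
    rw [i1, e1, h1, if_pos rfl, sub_self, zero_smul, smul_zero]
  · rw [ha χ hχ, if_neg (fun h => hχ (MonoidHom.ext fun g => by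
      simpa using DFunLike.congr_fun h g)), sub_zero]

/-- The determinant `z` and the adjugate `N` of a matrix over a ring which is commutative, although
this is only given as a hypothesis and not as an instance. -/
theorem exists_adjugate_of_commute {A n : Type*} [Ring A] (hA : ∀ a b : A, a * b = b * a)
    [Fintype n] [DecidableEq n] (M : Matrix n n A) :
    ∃ (z : A) (N : Matrix n n A), (∀ i j, (N * M) i j = if i = j then z else 0) ∧
      ∀ (f : A →+* ℂ), f z = (M.map f).det := by
  let _ : CommRing A := { ‹Ring A› with mul_comm := hA }
  refine ⟨M.det, M.adjugate, fun i j => ?_, fun f => RingHom.map_det f M⟩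
  rw [Matrix.adjugate_mul]
  simp [Matrix.one_apply]

/-! ### Periodic sequences and primitive words -/

/-- The seqShift on sequences. -/
def seqShift {α : Type*} (f : ℕ → α) : ℕ → α := fun i => f (i + 1)

theorem seqShift_iterate {α : Type*} (f : ℕ → α) (k i : ℕ) : seqShift^[k] f i = f (i + k) := by
  induction k generalizing f with
  | zero => rfl
  | succ k ih => rw [Function.iterate_succ_apply, ih]; simp [seqShift, add_assoc]

theorem isPeriodicPt_seqShift_iff {α : Type*} {f : ℕ → α} {n : ℕ} :
    Function.IsPeriodicPt seqShift n f ↔ ∀ i, f (i + n) = f i := by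
  rw [Function.IsPeriodicPt, Function.IsFixedPt, funext_iff]
  simp only [seqShift_iterate]

theorem apply_mod_of_isPeriodicPt {α : Type*} {f : ℕ → α} {n : ℕ}
    (hf : Function.IsPeriodicPt seqShift n f) (i : ℕ) : f (i % n) = f i := by
  have := congrFun (hf.iterate_mod_apply i) 0
  simpa [seqShift_iterate] using this

namespace List

variable {α : Type*}

/-- The periodic sequence `l l l …` obtained by repeating a nonempty word `l`. -/
def cyc (l : List α) (h : l ≠ []) (i : ℕ) : α := l[i % l.length]'(Nat.mod_lt _ (length_pos_iff.2 h))

theorem cyc_of_lt {l : List α} (h : l ≠ []) {i : ℕ} (hi : i < l.length) : l.cyc h i = l[i] := by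
  simp [cyc, Nat.mod_eq_of_lt hi]

theorem isPeriodicPt_cyc {l : List α} (h : l ≠ []) :
    Function.IsPeriodicPt seqShift l.length (l.cyc h) := by
  rw [isPeriodicPt_seqShift_iff]
  intro i
  simp [cyc]

theorem eq_of_cyc_eq {l l' : List α} {h : l ≠ []} {h' : l' ≠ []} (hlen : l.length = l'.length)
    (hc : l.cyc h = l'.cyc h') : l = l' := by
  refine ext_getElem hlen fun i hi hi' => ?_
  rw [← cyc_of_lt h hi, ← cyc_of_lt h' hi', hc]

theorem cyc_rotate {l : List α} (h : l ≠ []) (k : ℕ) (h' : l.rotate k ≠ []) :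
    (l.rotate k).cyc h' = seqShift^[k] (l.cyc h) := by
  funext i
  simp [cyc, seqShift_iterate, getElem_rotate]

theorem cyc_ofFn {f : ℕ → α} {n : ℕ} (hf : Function.IsPeriodicPt seqShift n f)
    (h : ofFn (fun i : Fin n => f i) ≠ []) : (ofFn fun i : Fin n => f i).cyc h = f := by
  funext i
  simp [cyc, apply_mod_of_isPeriodicPt hf]

theorem cyc_flatten_replicate {C : List α} (hC : C ≠ []) (a : ℕ)
    (h : (replicate a C).flatten ≠ []) : (replicate a C).flatten.cyc h = C.cyc hC := by
  have key : ∀ (a i : ℕ) (hi : i < (replicate a C).flatten.length),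
      (replicate a C).flatten[i] = C.cyc hC i := by
    intro a
    induction a with
    | zero => intro i hi; simp at hi
    | succ a ih =>
      intro i hi
      simp only [replicate_succ, flatten_cons, getElem_append]
      split_ifs with h1
      · rw [cyc_of_lt hC h1]
      · rw [ih]
        have := isPeriodicPt_seqShift_iff.1 (isPeriodicPt_cyc hC) (i - C.length)
        rw [← this, Nat.sub_add_cancel (not_lt.1 h1)]
  funext i
  rw [cyc, key]
  have hd : C.length ∣ (replicate a C).flatten.length := by simp
  rw [cyc, cyc]
  congr 1
  exact Nat.mod_mod_of_dvd _ hd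

/-- A relation holds between cyclically consecutive letters of `l` if and only if it holds between
consecutive terms of the periodic sequence `l l l …`. -/
theorem isChain_and_closed_iff (r : α → α → Prop) {l : List α} (h : l ≠ []) :
    (l.IsChain r ∧ ∀ a ∈ l.getLast?, ∀ b ∈ l.head?, r a b) ↔
      ∀ i, r (l.cyc h i) (l.cyc h (i + 1)) := by
  have hpos := length_pos_iff.2 h
  have hlast : (∀ a ∈ l.getLast?, ∀ b ∈ l.head?, r a b) ↔ r (l[l.length - 1]) (l[0]) := by
    simp [getLast?_eq_some_getLast h, head?_eq_some_head h, getLast_eq_getElem, head_eq_getElem]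
  rw [hlast, isChain_iff_getElem]
  constructor
  · rintro ⟨h1, h2⟩ i
    have hi := Nat.mod_lt i hpos
    rcases lt_or_ge (i % l.length + 1) l.length with h3 | h3
    · have e : (i + 1) % l.length = i % l.length + 1 := by
        rw [Nat.add_mod, ← Nat.mod_eq_of_lt h3]
        simp
      simp only [cyc, e]
      exact h1 _ h3
    · have e1 : i % l.length = l.length - 1 := by omega
      have e : (i + 1) % l.length = 0 := by
        rw [← Nat.mod_add_mod, e1, Nat.sub_add_cancel hpos, Nat.mod_self]
      simp only [cyc, e, e1]
      exact h2
  · intro H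
    constructor
    · intro i hi
      have := H i
      rwa [cyc_of_lt h (by omega), cyc_of_lt h hi] at this
    · have := H (l.length - 1)
      rw [cyc_of_lt h (by omega), Nat.sub_add_cancel hpos] at this
      simpa [cyc] using this

end List

theorem prod_range_mul_period {M : Type*} [CommMonoid M] {f : ℕ → M} {n : ℕ}
    (hf : Function.IsPeriodicPt seqShift n f) (k : ℕ) :
    ∏ i ∈ Finset.range (n * k), f i = (∏ i ∈ Finset.range n, f i) ^ k := by
  induction k with
  | zero => simp
  | succ k ih =>
    rw [mul_add, mul_one, Finset.prod_range_add, ih, pow_succ]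
    congr 1
    refine Finset.prod_congr rfl fun i _ => ?_
    have := isPeriodicPt_seqShift_iff.1 (hf.mul_const k) i
    rw [← this, add_comm, mul_comm]

namespace Multigraph

variable {V E : Type*} (X : Multigraph V E)

/-- `b` may follow `a` in a path without backtrack. -/
def Follows (a b : E) : Prop := X.terminus a = X.origin b ∧ b ≠ X.inv a

theorem isClosedPath_iff {l : List E} (h : l ≠ []) :
    X.IsClosedPath l ↔ ∀ i, X.terminus (l.cyc h i) = X.origin (l.cyc h (i + 1)) := by
  rw [← List.isChain_and_closed_iff (fun a b => X.terminus a = X.origin b) h]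
  simp [IsClosedPath, IsPath, h]

theorem reduced_iff {l : List E} (h : l ≠ []) :
    (X.IsClosedPath l ∧ ¬ X.HasBacktrack l ∧ ¬ X.HasTail l) ↔
      ∀ i, X.Follows (l.cyc h i) (l.cyc h (i + 1)) := by
  simp only [Follows, forall_and]
  rw [← List.isChain_and_closed_iff (fun a b => b ≠ X.inv a) h, X.isClosedPath_iff h]
  simp only [HasBacktrack, HasTail, not_not, not_exists, not_and]
  tauto

variable {X}

theorem IsPrimePath.ne_nil {l : List E} (hl : X.IsPrimePath l) : l ≠ [] := hl.1.1.1

theorem IsPrimePath.follows {l : List E} (hl : X.IsPrimePath l) (i : ℕ) :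
    X.Follows (l.cyc hl.ne_nil i) (l.cyc hl.ne_nil (i + 1)) :=
  (X.reduced_iff hl.ne_nil).1 ⟨hl.1, hl.2.1, hl.2.2.1⟩ i

/-- A prime path is not a proper power, so its length is the least period of the sequence obtained
by repeating it. -/
theorem IsPrimePath.minimalPeriod_cyc {l : List E} (hl : X.IsPrimePath l) :
    Function.minimalPeriod seqShift (l.cyc hl.ne_nil) = l.length := by
  have hper := List.isPeriodicPt_cyc hl.ne_nil
  have hpos := hper.minimalPeriod_pos (List.length_pos_iff.2 hl.ne_nil)
  set d := Function.minimalPeriod seqShift (l.cyc hl.ne_nil) with hd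
  obtain ⟨a, ha⟩ := hper.minimalPeriod_dvd
  rw [← hd] at ha
  by_contra hne
  have ha2 : 2 ≤ a := by
    rcases a with _ | _ | a
    · exact absurd (List.length_pos_iff.2 hl.ne_nil) (by omega)
    · omega
    · omega
  refine hl.2.2.2 ⟨List.ofFn fun i : Fin d => l.cyc hl.ne_nil i, ?_, a, ha2, ?_⟩
  all_goals
    have hC : (List.ofFn fun i : Fin d => l.cyc hl.ne_nil i) ≠ [] := by
      simp [hpos.ne']
  · rw [X.isClosedPath_iff hC, List.cyc_ofFn (Function.isPeriodicPt_minimalPeriod _ _)]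
    exact fun i => (hl.follows i).1
  · have hF : (List.replicate a (List.ofFn fun i : Fin d => l.cyc hl.ne_nil i)).flatten ≠ [] := by
      rw [← List.length_pos_iff]
      simp
      omega
    refine List.eq_of_cyc_eq (h := hl.ne_nil) (h' := hF) ?_ ?_
    · simp [ha, mul_comm]
    · rw [List.cyc_flatten_replicate hC, List.cyc_ofFn (Function.isPeriodicPt_minimalPeriod _ _)]

/-- Conversely, one minimal period of a periodic sequence without backtracking is a prime path. -/
theorem isPrimePath_ofFn {f : ℕ → E} (hf : f ∈ Function.periodicPts seqShift)
    (hfol : ∀ i, X.Follows (f i) (f (i + 1))) :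
    X.IsPrimePath (List.ofFn fun i : Fin (Function.minimalPeriod seqShift f) => f i) := by
  have hpos := Function.minimalPeriod_pos_of_mem_periodicPts hf
  have hper := Function.isPeriodicPt_minimalPeriod seqShift f
  set d := Function.minimalPeriod seqShift f with hd
  have hne : (List.ofFn fun i : Fin d => f i) ≠ [] := by simp [hpos.ne']
  have hcyc := List.cyc_ofFn hper hne
  have := (X.reduced_iff hne).2 (by rw [hcyc]; exact hfol)
  refine ⟨this.1, this.2.1, this.2.2, ?_⟩
  rintro ⟨C, hC, a, ha, h⟩
  have hF : (List.replicate a C).flatten ≠ [] := h ▸ hne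
  have e : f = C.cyc hC.1.1 := by
    rw [← hcyc, ← List.cyc_flatten_replicate hC.1.1 a hF]
    congr 1
  have hp := List.isPeriodicPt_cyc hC.1.1
  rw [← e] at hp
  have hle := hp.minimalPeriod_le (List.length_pos_iff.2 hC.1.1)
  have hlen := congrArg List.length h
  simp at hlen
  have hC0 := List.length_pos_iff.2 hC.1.1
  nlinarith

theorem IsPrimePath.rotate {l : List E} (hl : X.IsPrimePath l) (k : ℕ) :
    X.IsPrimePath (l.rotate k) := by
  have hne : l.rotate k ≠ [] := by simpa using hl.ne_nil
  have hp : seqShift^[k] (l.cyc hl.ne_nil) ∈ Function.periodicPts seqShift :=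
    Function.mk_mem_periodicPts (List.length_pos_iff.2 hl.ne_nil)
      ((List.isPeriodicPt_cyc hl.ne_nil).apply_iterate k)
  have hm := Function.minimalPeriod_apply_iterate
    (Function.mk_mem_periodicPts (List.length_pos_iff.2 hl.ne_nil)
      (List.isPeriodicPt_cyc hl.ne_nil)) k
  have h := isPrimePath_ofFn (X := X) hp (fun i => by
    simpa [seqShift_iterate, add_right_comm] using hl.follows (i + k))
  convert h using 1
  refine List.eq_of_cyc_eq (h := hne) (h' := h.ne_nil) ?_ ?_
  · rw [List.length_ofFn, hm, hl.minimalPeriod_cyc, List.length_rotate]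
  · rw [List.cyc_ofFn (Function.isPeriodicPt_minimalPeriod _ _), List.cyc_rotate]

end Multigraph

/-! ### Primes and traces of the non-backtracking edge matrix -/

namespace Multigraph

variable {V E : Type*} {X : Multigraph V E}

theorem toPrime_eq_iff {l l' : {l : List E // X.IsPrimePath l}} :
    X.toPrime l = X.toPrime l' ↔ l.1.IsRotated l'.1 :=
  Quotient.eq (r := X.primeSetoid)

theorem Prime.exists_toPrime (p : X.Prime) : ∃ l, X.toPrime l = p := Quotient.exists_rep p

theorem Prime.length_pos (p : X.Prime) : 0 < p.length := by
  obtain ⟨l, rfl⟩ := p.exists_toPrime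
  exact List.length_pos_iff.2 l.2.ne_nil

theorem finite_primes_length_le [Finite E] (n : ℕ) : {p : X.Prime | p.length ≤ n}.Finite := by
  have h := (List.finite_length_le E n).preimage
    (f := (Subtype.val : {l : List E // X.IsPrimePath l} → List E)) Subtype.val_injective.injOn
  refine (h.image X.toPrime).subset fun p hp => ?_
  obtain ⟨l, rfl⟩ := p.exists_toPrime
  exact ⟨l, hp, rfl⟩

/-- A prime path representing a prime. -/
noncomputable def Prime.rep (p : X.Prime) : {l : List E // X.IsPrimePath l} :=
  p.exists_toPrime.choose

theorem Prime.toPrime_rep (p : X.Prime) : X.toPrime p.rep = p := p.exists_toPrime.choose_spec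

theorem Prime.length_rep (p : X.Prime) : p.rep.1.length = p.length := by
  conv_rhs => rw [← p.toPrime_rep]
  rfl

/-- The periodic sequence obtained by repeating the representative of a prime. -/
noncomputable def Prime.seq (p : X.Prime) : ℕ → E := p.rep.1.cyc p.rep.2.ne_nil

theorem Prime.isPeriodicPt_seq (p : X.Prime) : Function.IsPeriodicPt seqShift p.length p.seq := by
  rw [← p.length_rep]
  exact List.isPeriodicPt_cyc _

theorem Prime.minimalPeriod_seq (p : X.Prime) : Function.minimalPeriod seqShift p.seq = p.length := by
  rw [← p.length_rep]
  exact p.rep.2.minimalPeriod_cyc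

theorem Prime.mem_periodicPts_seq (p : X.Prime) : p.seq ∈ Function.periodicPts seqShift :=
  Function.mk_mem_periodicPts p.length_pos p.isPeriodicPt_seq

theorem Prime.follows_seq (p : X.Prime) (i : ℕ) : X.Follows (p.seq i) (p.seq (i + 1)) :=
  p.rep.2.follows i

/-- The shifts `j < ν(p)` of the sequences of the primes `p` are pairwise distinct. -/
theorem Prime.eq_and_eq_of_seqShift_seq_eq {p q : X.Prime} {j k : ℕ} (hj : j < p.length)
    (hk : k < q.length) (h : seqShift^[j] p.seq = seqShift^[k] q.seq) : p = q ∧ j = k := by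
  have hlen : p.length = q.length := by
    rw [← p.minimalPeriod_seq, ← q.minimalPeriod_seq,
      ← Function.minimalPeriod_apply_iterate p.mem_periodicPts_seq j, h,
      Function.minimalPeriod_apply_iterate q.mem_periodicPts_seq k]
  have hpq : p = q := by
    have h1 : (p.rep.1.rotate j) ≠ [] := (p.rep.2.rotate j).ne_nil
    have h2 : (q.rep.1.rotate k) ≠ [] := (q.rep.2.rotate k).ne_nil
    have e : p.rep.1.rotate j = q.rep.1.rotate k := by
      refine List.eq_of_cyc_eq (h := h1) (h' := h2) ?_ ?_
      · simp [Prime.length_rep, hlen]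
      · rw [List.cyc_rotate p.rep.2.ne_nil, List.cyc_rotate q.rep.2.ne_nil]
        exact h
    rw [← p.toPrime_rep, ← q.toPrime_rep, toPrime_eq_iff]
    exact (List.IsRotated.forall p.rep.1 j).symm.trans (e ▸ List.IsRotated.forall q.rep.1 k)
  subst hpq
  refine ⟨rfl, ?_⟩
  rw [← p.minimalPeriod_seq] at hj hk
  exact Function.iterate_injOn_Iio_minimalPeriod hj hk h

/-- Every periodic sequence without backtracking is a seqShift of the sequence of some prime. -/
theorem Prime.exists_seqShift_seq_eq {f : ℕ → E} (hf : f ∈ Function.periodicPts seqShift)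
    (hfol : ∀ i, X.Follows (f i) (f (i + 1))) :
    ∃ (p : X.Prime) (j : ℕ), p.length = Function.minimalPeriod seqShift f ∧ j < p.length ∧
      seqShift^[j] p.seq = f := by
  have hl := isPrimePath_ofFn hf hfol
  set l := List.ofFn fun i : Fin (Function.minimalPeriod seqShift f) => f i with hl'
  obtain ⟨j, hj⟩ : (X.toPrime ⟨l, hl⟩).rep.1.IsRotated l :=
    toPrime_eq_iff.1 (X.toPrime ⟨l, hl⟩).toPrime_rep
  refine ⟨X.toPrime ⟨l, hl⟩, j % (X.toPrime ⟨l, hl⟩).length, ?_, Nat.mod_lt _ (Prime.length_pos _), ?_⟩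
  · exact List.length_ofFn
  · rw [(Prime.isPeriodicPt_seq _).iterate_mod_apply, Prime.seq,
      ← List.cyc_rotate _ _ fun h => hl.ne_nil (hj.symm.trans h)]
    have h : ∀ (l' : List E) (h' : l' ≠ []), l' = l → l'.cyc h' = f := by
      rintro l' h' rfl
      exact List.cyc_ofFn (Function.isPeriodicPt_minimalPeriod _ _) _
    exact h _ _ hj

theorem Prime.prod_range_seqShift_seq {K : Type*} [CommRing K] {c : E → K} {w : X.Prime → K}
    (hw : ∀ l, w (X.toPrime l) = (l.1.map c).prod) (p : X.Prime) (j : ℕ) {m : ℕ}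
    (hm : p.length ∣ m) :
    ∏ i ∈ Finset.range m, c (p.seq (i + j)) = w p ^ (m / p.length) := by
  obtain ⟨k, rfl⟩ := hm
  have hper : Function.IsPeriodicPt seqShift p.length fun i => c (p.seq (i + j)) := by
    rw [isPeriodicPt_seqShift_iff]
    intro i
    rw [add_right_comm, isPeriodicPt_seqShift_iff.1 p.isPeriodicPt_seq]
  rw [prod_range_mul_period hper, Nat.mul_div_cancel_left _ p.length_pos]
  congr 1
  have hr := p.rep.2.rotate j
  have e : w p = w (X.toPrime ⟨p.rep.1.rotate j, hr⟩) := by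
    congr 1
    conv_lhs => rw [← p.toPrime_rep]
    exact toPrime_eq_iff.2 (List.IsRotated.forall p.rep.1 j).symm
  have hlen : p.length = ((p.rep.1.rotate j).map c).length := by
    rw [List.length_map, List.length_rotate, p.length_rep]
  rw [e, hw, ← Fin.prod_univ_getElem, hlen, Finset.prod_range]
  refine Finset.prod_congr rfl fun i _ => ?_
  have := congrFun (List.cyc_rotate p.rep.2.ne_nil j hr.ne_nil) i
  rw [List.cyc_of_lt _ (by simpa using i.2), seqShift_iterate] at this
  simp only [List.getElem_map]
  rw [this]
  rfl

open Classical in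
/-- The non-backtracking edge matrix of `X`, with entry `c a` at `(a, b)` when `b` may follow `a`. -/
noncomputable def edgeMatrix (X : Multigraph V E) {K : Type*} [CommRing K] (c : E → K) :
    Matrix E E K :=
  Matrix.of fun a b => if X.Follows a b then c a else 0

/-- The trace of `W ^ m` counts closed words of length `m` without backtracking; each of them is
given by a prime `p` with `ν(p) ∣ m` and one of the `ν(p)` starting points on it. -/
theorem trace_edgeMatrix_pow [Fintype E] [DecidableEq E] {K : Type*} [CommRing K] {c : E → K}
    {w : X.Prime → K} (hw : ∀ l, w (X.toPrime l) = (l.1.map c).prod) {m : ℕ} (hm : 0 < m)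
    (s : Finset X.Prime) (hs : ∀ p : X.Prime, p.length ≤ m → p ∈ s) :
    (X.edgeMatrix c ^ m).trace =
      ∑ p ∈ s with p.length ∣ m, (p.length : K) * w p ^ (m / p.length) := by
  classical
  have hper : ∀ p : X.Prime, p.length ∣ m → ∀ j, Function.IsPeriodicPt seqShift m (seqShift^[j] p.seq) :=
    fun p hp j => (p.isPeriodicPt_seq.trans_dvd hp).apply_iterate j
  rw [Matrix.trace_pow_eq_sum_closed_paths]
  have h1 : ∀ p ∈ s.filter (fun p => p.length ∣ m), (p.length : K) * w p ^ (m / p.length) =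
      ∑ j ∈ Finset.range p.length, w p ^ (m / p.length) := by
    intro p _
    simp
  rw [Finset.sum_congr rfl h1, Finset.sum_sigma']
  symm
  refine Finset.sum_of_injOn (fun x (i : Fin (m + 1)) => x.1.seq (i + x.2)) ?_ ?_ ?_ ?_
  · rintro ⟨p, j⟩ hp ⟨q, k⟩ hq h
    simp only [Finset.coe_sigma, Set.mem_sigma_iff, Finset.mem_coe, Finset.mem_filter,
      Finset.mem_range] at hp hq
    have e : seqShift^[j] p.seq = seqShift^[k] q.seq := by
      funext i
      rw [← apply_mod_of_isPeriodicPt (hper p hp.1.2 j) i,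
        ← apply_mod_of_isPeriodicPt (hper q hq.1.2 k) i, seqShift_iterate, seqShift_iterate]
      exact congrFun h ⟨i % m, (Nat.mod_lt i hm).trans (Nat.lt_succ_self m)⟩
    obtain ⟨rfl, rfl⟩ := Prime.eq_and_eq_of_seqShift_seq_eq hp.2 hq.2 e
    rfl
  · intro _ _
    simp
  · intro g _ hg
    by_contra hne
    apply hg
    have hcl : g (Fin.last m) = g 0 := by
      by_contra h
      exact hne (if_neg h)
    rw [if_pos hcl] at hne
    have hfol : ∀ i : Fin m, X.Follows (g i.castSucc) (g i.succ) := by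
      intro i
      by_contra h
      exact hne (Finset.prod_eq_zero (Finset.mem_univ i) (by simp [edgeMatrix, h]))
    -- The closed word `g` extends to a periodic sequence.
    let f : ℕ → E := fun i => g ⟨i % m, (Nat.mod_lt i hm).trans (Nat.lt_succ_self m)⟩
    have hfg : ∀ i : Fin (m + 1), f i = g i := by
      intro i
      rcases Nat.lt_or_ge i m with h | h
      · exact congrArg g (Fin.ext (Nat.mod_eq_of_lt h))
      · have e : i = Fin.last m := Fin.ext (by have := i.2; simp; omega)
        rw [e, hcl]
        exact congrArg g (Fin.ext (by simp))
    have hfp : Function.IsPeriodicPt seqShift m f := by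
      rw [isPeriodicPt_seqShift_iff]
      intro i
      simp [f]
    have hff : ∀ i, X.Follows (f i) (f (i + 1)) := by
      intro i
      have h := hfol ⟨i % m, Nat.mod_lt i hm⟩
      have e1 : f i = g (Fin.castSucc ⟨i % m, Nat.mod_lt i hm⟩) := rfl
      have e2 : f (i + 1) = g (Fin.succ ⟨i % m, Nat.mod_lt i hm⟩) := by
        rw [← hfg, ← apply_mod_of_isPeriodicPt hfp (i + 1), ← Nat.mod_add_mod,
          apply_mod_of_isPeriodicPt hfp]
        rfl
      rwa [e1, e2]
    obtain ⟨p, j, hp, hj, hpf⟩ :=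
      Prime.exists_seqShift_seq_eq (Function.mk_mem_periodicPts hm hfp) hff
    have hdvd : p.length ∣ m := hp ▸ hfp.minimalPeriod_dvd
    refine ⟨⟨p, j⟩, ?_, ?_⟩
    · simp only [Finset.coe_sigma, Set.mem_sigma_iff, Finset.mem_coe, Finset.mem_filter,
        Finset.mem_range]
      exact ⟨⟨hs p (Nat.le_of_dvd hm hdvd), hdvd⟩, hj⟩
    · funext i
      rw [← hfg, ← hpf, seqShift_iterate]
  · rintro ⟨p, j⟩ hp
    simp only [Finset.mem_sigma, Finset.mem_filter, Finset.mem_range] at hp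
    have hcl := isPeriodicPt_seqShift_iff.1 (hper p hp.1.2 j) 0
    simp only [seqShift_iterate] at hcl
    rw [if_pos (by simpa using hcl), ← p.prod_range_seqShift_seq hw j hp.1.2, Finset.prod_range]
    refine Finset.prod_congr rfl fun i _ => ?_
    have := p.follows_seq (i + j)
    rw [edgeMatrix, Matrix.of_apply, if_pos]
    · simp
    · simpa [add_right_comm] using this

end Multigraph

/-! ### The Ihara–Bass determinant formula -/

namespace Multigraph

variable {V E : Type*} (X : Multigraph V E)

/-- The edges can be oriented: `p` selects one of `e`, `X.inv e` for each edge. -/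
theorem exists_orientation [Finite E] : ∃ p : E → Prop, ∀ e, p (X.inv e) ↔ ¬ p e := by
  obtain ⟨n, ⟨f⟩⟩ := Finite.exists_equiv_fin E
  refine ⟨fun e => f e < f (X.inv e), fun e => ?_⟩
  have : f (X.inv e) ≠ f e := fun h => X.inv_ne e (f.injective h)
  simp only [X.inv_inv]
  omega

variable {R : Type*} [CommRing R]

/-- The adjacency matrix of `X` with weight `c e` on the oriented edge `e`. -/
def adjMatrix {A : Type*} [AddCommMonoid A] [Fintype E] [DecidableEq V] (c : E → A) :
    Matrix V V A :=
  Matrix.of fun v w => ∑ e, if X.origin e = v ∧ X.terminus e = w then c e else 0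

/-- The matrix of the reversal of edges, with weight `c a` at `(a, X.inv a)`. -/
def revMatrix [DecidableEq E] (c : E → R) : Matrix E E R :=
  Matrix.of fun a b => if b = X.inv a then c a else 0

variable {X}

theorem revMatrix_mul_revMatrix [Fintype E] [DecidableEq E] {c : E → R}
    (hc : ∀ e, c e * c (X.inv e) = 1) : X.revMatrix c * X.revMatrix c = 1 := by
  ext a b
  rw [Matrix.mul_apply, Finset.sum_eq_single (X.inv a)]
  · simp [revMatrix, X.inv_inv, Matrix.one_apply, hc, eq_comm]
  · intro x _ hx
    simp [revMatrix, hx]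
  · simp

/-- Here `m` is the number of unoriented edges. For an orientation `p`, the matrix is
`[1, *; *, 1]` in blocks, and the product of the off-diagonal blocks is `u²`. -/
theorem exists_det_one_sub_smul_revMatrix [Fintype E] [DecidableEq E] :
    ∃ m : ℕ, Fintype.card E = 2 * m ∧ ∀ {R : Type*} [CommRing R] (c : E → R),
      (∀ e, c e * c (X.inv e) = 1) → ∀ u : R, (1 - u • X.revMatrix c).det = (1 - u ^ 2) ^ m := by
  classical
  obtain ⟨p, hp⟩ := X.exists_orientation
  refine ⟨Fintype.card {e // p e}, ?_, ?_⟩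
  · have e : {e // p e} ≃ {e // ¬ p e} :=
      { toFun := fun e => ⟨X.inv e, fun h => (hp e).1 h e.2⟩
        invFun := fun e => ⟨X.inv e, (hp e).2 e.2⟩
        left_inv := fun e => Subtype.ext (X.inv_inv e)
        right_inv := fun e => Subtype.ext (X.inv_inv e) }
    rw [← Fintype.card_congr (Equiv.sumCompl p), Fintype.card_sum, ← Fintype.card_congr e, two_mul]
  · intro R _ c hc u
    have h1 : Matrix.toBlock (1 - u • X.revMatrix c) p p = 1 := by
      ext a b
      have : (b : E) ≠ X.inv a := fun h => (hp a).1 (h ▸ b.2) a.2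
      simp [revMatrix, this, Matrix.one_apply, Subtype.ext_iff]
    have h2 : Matrix.toBlock (1 - u • X.revMatrix c) (fun e => ¬ p e) (fun e => ¬ p e) = 1 := by
      ext a b
      have : (b : E) ≠ X.inv a := fun h => b.2 (h ▸ (hp a).2 a.2)
      simp [revMatrix, this, Matrix.one_apply, Subtype.ext_iff]
    have h3 : Matrix.toBlock (1 - u • X.revMatrix c) p (fun e => ¬ p e) *
        Matrix.toBlock (1 - u • X.revMatrix c) (fun e => ¬ p e) p = u ^ 2 • 1 := by
      ext a b
      rw [Matrix.mul_apply, Finset.sum_eq_single ⟨X.inv a, fun h => (hp a).1 h a.2⟩]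
      · have n1 : (a : E) ≠ X.inv a := (X.inv_ne a).symm
        by_cases hab : a = b
        · subst hab
          have := hc a
          simp [revMatrix, X.inv_inv, n1, n1.symm]
          linear_combination u ^ 2 * this
        · have hab' : (b : E) ≠ a := fun h => hab (Subtype.ext h.symm)
          have n2 : X.inv a ≠ b := fun h => (hp a).1 (h ▸ b.2) a.2
          simp [revMatrix, X.inv_inv, Matrix.one_apply, hab, hab', n2]
      · intro x _ hx
        have n1 : (x : E) ≠ X.inv a := fun h => hx (Subtype.ext h)
        have n2 : (a : E) ≠ x := fun h => x.2 (h ▸ a.2)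
        simp [revMatrix, n1, Matrix.one_apply, n2]
      · simp
    rw [Matrix.det_toBlock _ p, h1, h2, Matrix.det_fromBlocks_one₂₂, h3]
    have : (1 : Matrix {e // p e} {e // p e} R) - u ^ 2 • 1 = (1 - u ^ 2) • 1 := by
      rw [sub_smul, one_smul]
    rw [this, Matrix.det_smul, Matrix.det_one, mul_one]

theorem sum_origin_eq_degree [Fintype E] [DecidableEq V] (v : V) :
    (∑ e, if X.origin e = v then (1 : R) else 0) = X.degree v := by
  rw [degree, Nat.card_eq_fintype_card, Fintype.card_subtype, Finset.sum_boole]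

/-- The Ihara–Bass formula, for weights with `c(e) c(e⁻¹) = 1`; `m` is the number of unoriented
edges. With `J` the weighted edge reversal, the edge matrix is `T * S - J`, where `S * T` is the
adjacency matrix; multiplication by `1 - uJ` reduces the claim to the comparison of the
characteristic polynomials of `P * S` and `S * P`. -/
theorem ihara_bass [Fintype V] [DecidableEq V] [Fintype E] [DecidableEq E] :
    ∃ m : ℕ, Fintype.card E = 2 * m ∧ ∀ {R : Type*} [CommRing R] [IsDomain R] (c : E → R),
      (∀ e, c e * c (X.inv e) = 1) → ∀ u : R, 1 - u ^ 2 ≠ 0 →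
      (1 - u ^ 2) ^ Fintype.card V * (1 - u • X.edgeMatrix c).det =
        (1 - u ^ 2) ^ m * ((1 - u ^ 2) • 1 - u • X.adjMatrix c +
          u ^ 2 • Matrix.diagonal fun v => (X.degree v : R)).det := by
  obtain ⟨m, hm, hdet⟩ := X.exists_det_one_sub_smul_revMatrix
  refine ⟨m, hm, fun {R} _ _ c hc u hq => ?_⟩
  set q := 1 - u ^ 2 with hqdef
  set J := X.revMatrix c with hJ
  let S : Matrix V E R := Matrix.of fun v e => if X.origin e = v then 1 else 0
  let T : Matrix E V R := Matrix.of fun e v => if X.terminus e = v then c e else 0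
  -- `S` records initial vertices and `T` weighted terminal vertices.
  have hJJ : J * J = 1 := revMatrix_mul_revMatrix hc
  have hW : X.edgeMatrix c = T * S - J := by
    ext a b
    have : (T * S) a b = if X.terminus a = X.origin b then c a else 0 := by
      rw [Matrix.mul_apply, Finset.sum_eq_single (X.terminus a)]
      · simp [T, S, eq_comm]
      · intro x _ hx
        simp [T, hx.symm]
      · simp
    rw [Matrix.sub_apply, this, hJ]
    by_cases h : b = X.inv a
    · subst h
      simp [edgeMatrix, revMatrix, Follows, terminus]
    · simp [edgeMatrix, revMatrix, Follows, h]
  have hST : S * T = X.adjMatrix c := by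
    ext v w
    rw [Matrix.mul_apply]
    refine Finset.sum_congr rfl fun e _ => ?_
    by_cases h : X.origin e = v <;> simp [S, T, h]
  have hSJT : S * (J * T) = Matrix.diagonal fun v => (X.degree v : R) := by
    ext v w
    have hJT : ∀ e, (J * T) e w = if X.origin e = w then 1 else 0 := by
      intro e
      rw [Matrix.mul_apply, Finset.sum_eq_single (X.inv e)]
      · simp [hJ, revMatrix, T, terminus, X.inv_inv, hc]
      · intro x _ hx
        simp [hJ, revMatrix, hx]
      · simp
    rw [Matrix.mul_apply]
    simp only [hJT]
    by_cases h : v = w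
    · subst h
      rw [Matrix.diagonal_apply_eq, ← sum_origin_eq_degree]
      refine Finset.sum_congr rfl fun e _ => ?_
      by_cases h : X.origin e = v <;> simp [S, h]
    · rw [Matrix.diagonal_apply_ne _ h]
      refine Finset.sum_eq_zero fun e _ => ?_
      by_cases h' : X.origin e = v
      · have : X.origin e ≠ w := fun h'' => h (h'.symm.trans h'')
        simp [this]
      · simp [S, h']
  let P : Matrix E V R := u • (T - u • (J * T))
  have hprod : (1 - u • J) * (1 - u • X.edgeMatrix c) = Matrix.scalar E q - P * S := by
    have : Matrix.scalar E q = 1 - (u ^ 2) • (J * J) := by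
      rw [hJJ, hqdef, Matrix.scalar_apply, ← Matrix.smul_one_eq_diagonal, sub_smul, one_smul]
    rw [this, hW]
    simp only [P, smul_sub, sub_mul, mul_sub, Matrix.sub_mul, Matrix.smul_mul, Matrix.mul_smul, smul_smul,
      Matrix.mul_assoc, one_mul, mul_one, pow_two]
    abel
  have hSP : S * P = u • X.adjMatrix c - u ^ 2 • Matrix.diagonal fun v => (X.degree v : R) := by
    simp only [P, Matrix.mul_smul, Matrix.mul_sub, smul_sub, hST, hSJT, smul_smul, pow_two]
  have hcomm := congrArg (Polynomial.eval q) (Matrix.charpoly_mul_comm' P S)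
  simp only [Polynomial.eval_mul, Polynomial.eval_pow, Polynomial.eval_X,
    Matrix.eval_charpoly] at hcomm
  rw [← hprod, Matrix.det_mul, hdet c hc u, hSP, hm, two_mul, pow_add, Matrix.scalar_apply,
    ← Matrix.smul_one_eq_diagonal] at hcomm
  refine mul_left_cancel₀ (pow_ne_zero m hq) ?_
  rw [← sub_add] at hcomm
  linear_combination hcomm

end Multigraph

/-! ### Lifting paths along a Galois cover -/

namespace Multigraph

namespace Cover

variable {VX EX VY EY : Type*} {X : Multigraph VX EX} {Y : Multigraph VY EY} (π : Cover Y X)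

theorem eq_of_origin_eq_of_onE_eq {e₁ e₂ : EY} (ho : Y.origin e₁ = Y.origin e₂)
    (he : π.onE e₁ = π.onE e₂) : e₁ = e₂ :=
  (π.lift (Y.origin e₂) (π.onE e₂) (π.origin_onE e₂)).unique ⟨ho, he⟩ ⟨rfl, rfl⟩

theorem terminus_onE (e : EY) : X.terminus (π.onE e) = π.onV (Y.terminus e) := by
  rw [terminus, π.inv_onE, π.origin_onE, terminus]

variable {π}

theorem origin_smul (g : π.Aut) (e : EY) : Y.origin (g.1.2 e) = g • Y.origin e := g.2.1 e

theorem terminus_smul (g : π.Aut) (e : EY) : Y.terminus (g.1.2 e) = g • Y.terminus e := by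
  rw [terminus, g.2.2.1, origin_smul, terminus]

theorem onV_smul (g : π.Aut) (w : VY) : π.onV (g • w) = π.onV w := g.2.2.2.1 w

theorem onE_smul (g : π.Aut) (e : EY) : π.onE (g.1.2 e) = π.onE e := g.2.2.2.2 e

/-- `Aut(Y/X)` acts freely on the vertices when `Y` is connected, by uniqueness of lifts. -/
theorem eq_one_of_smul_eq (hY : Y.Connected) {g : π.Aut} {w : VY} (hg : g • w = w) : g = 1 := by
  have hE : ∀ e, g • Y.origin e = Y.origin e → g.1.2 e = e := fun e h =>
    π.eq_of_origin_eq_of_onE_eq (by rw [origin_smul, h]) (onE_smul g e)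
  have hV : ∀ w' : VY, g • w' = w' := by
    intro w'
    induction hY.2 w w' with
    | refl => exact hg
    | tail _ h ih =>
      obtain ⟨e, rfl, rfl⟩ := h
      rw [← terminus_smul, hE e ih]
  exact Subtype.ext (Prod.ext (Equiv.ext hV) (Equiv.ext fun e => hE e (hV _)))

theorem eq_of_smul_eq_smul (hY : Y.Connected) {g h : π.Aut} {w : VY} (hg : g • w = h • w) :
    g = h := by
  have : (h⁻¹ * g) • w = w := by rw [mul_smul, hg, inv_smul_smul]
  exact (inv_mul_eq_one.1 (eq_one_of_smul_eq hY this)).symm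

variable (π)

/-- A voltage assignment trivializing a Galois cover: a section `sec` of the map on vertices, the
coordinate `coord w` of a vertex `w` of `Y`, i.e. the automorphism which moves the chosen vertex of
the fibre to `w`, and the voltage `volt e` of an oriented edge `e` of `X`, by which coordinates are
multiplied along every lift of `e`. -/
structure Voltage where
  /-- a vertex over each vertex -/
  sec : VX → VY
  /-- group coordinate -/
  coord : VY → π.Aut
  /-- the voltage of an oriented edge -/
  volt : EX → π.Aut
  onV_sec : ∀ v, π.onV (sec v) = v
  coord_smul_sec : ∀ w, coord w • sec (π.onV w) = w
  coord_sec : ∀ v, coord (sec v) = 1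
  coord_smul : ∀ g w, coord (g • w) = g * coord w
  coord_terminus : ∀ e, coord (Y.terminus e) = coord (Y.origin e) * volt (π.onE e)

theorem exists_voltage (hY : Y.Connected) (hGalois : π.IsGalois) : Nonempty π.Voltage := by
  choose sec hsec using π.surjective
  have hex : ∀ w, ∃ g : π.Aut, g • sec (π.onV w) = w := fun w => hGalois _ _ (hsec _)
  choose coord hcoord using hex
  have hlift : ∀ e : EX, ∃ e' : EY, Y.origin e' = sec (X.origin e) ∧ π.onE e' = e :=
    fun e => (π.lift (sec (X.origin e)) e (hsec _).symm).exists
  choose ℓ hℓo hℓ using hlift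
  have hsmul : ∀ g w, coord (g • w) = g * coord w := by
    intro g w
    refine eq_of_smul_eq_smul hY (w := sec (π.onV w)) ?_
    rw [mul_smul, hcoord w]
    conv_lhs => rw [← onV_smul g w]
    exact hcoord _
  refine ⟨⟨sec, coord, fun e => coord (Y.terminus (ℓ e)), hsec, hcoord, fun v => ?_, hsmul,
    fun e => ?_⟩⟩
  · refine eq_one_of_smul_eq hY (w := sec v) ?_
    have := hcoord (sec v)
    rwa [hsec] at this
  · have h : (coord (Y.origin e)).1.2 (ℓ (π.onE e)) = e := by
      refine π.eq_of_origin_eq_of_onE_eq ?_ ?_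
      · rw [origin_smul, hℓo, π.origin_onE, hcoord]
      · rw [onE_smul, hℓ]
    conv_lhs => rw [← h, terminus_smul, hsmul]

variable {π}

namespace Voltage

variable (ω : π.Voltage)

theorem volt_mul_volt_inv (e : EX) : ω.volt e * ω.volt (X.inv e) = 1 := by
  obtain ⟨e', -, rfl⟩ := (π.lift (ω.sec (X.origin e)) e (ω.onV_sec _).symm).exists
  have h1 := ω.coord_terminus e'
  have h2 := ω.coord_terminus (Y.inv e')
  rw [terminus, Y.inv_inv, ← π.inv_onE] at h2
  have h3 : Y.origin (Y.inv e') = Y.terminus e' := rfl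
  rw [h3, h1, mul_assoc] at h2
  exact left_eq_mul.1 h2

/-- Along a path of `Y`, coordinates are multiplied by the product of the voltages. -/
theorem coord_terminus_getLast {P : List EY} (hP : Y.IsPath P) :
    ∀ a ∈ P.head?, ∀ b ∈ P.getLast?,
      ω.coord (Y.terminus b) = ω.coord (Y.origin a) * ((P.map π.onE).map ω.volt).prod := by
  obtain ⟨hne, hch⟩ := hP
  induction P with
  | nil => exact absurd rfl hne
  | cons x P ih =>
    intro a ha b hb
    rw [List.head?_cons, Option.mem_some_iff] at ha
    subst ha
    rcases P with _ | ⟨y, P⟩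
    · simp at hb
      subst hb
      simpa using ω.coord_terminus x
    · rw [List.getLast?_cons_cons] at hb
      rw [List.isChain_cons_cons] at hch
      have := ih (by simp) hch.2 y (by simp) b hb
      rw [this, ← hch.1, ω.coord_terminus]
      simp [mul_assoc]

theorem exists_lift_path {l : List EX} (hl : X.IsPath l) (w : VY)
    (hw : ∀ a ∈ l.head?, X.origin a = π.onV w) :
    ∃ P : List EY, Y.IsPath P ∧ P.map π.onE = l ∧ ∀ a ∈ P.head?, Y.origin a = w := by
  obtain ⟨hne, hch⟩ := hl
  induction l generalizing w with
  | nil => exact absurd rfl hne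
  | cons x l ih =>
    obtain ⟨x', hx'o, rfl⟩ := (π.lift w x (hw x (by simp))).exists
    rcases l with _ | ⟨y, l⟩
    · exact ⟨[x'], ⟨by simp, by simp⟩, by simp, by simp [hx'o]⟩
    · rw [List.isChain_cons_cons] at hch
      obtain ⟨P, hP, hPm, hPo⟩ := ih (Y.terminus x') (by
        intro a ha
        simp at ha
        rw [← ha, ← hch.1, π.terminus_onE]) (by simp) hch.2
      rcases P with _ | ⟨z, P⟩
      · exact absurd rfl hP.1
      · refine ⟨x' :: z :: P, ⟨by simp, ?_⟩, by rw [List.map_cons, hPm], by simp [hx'o]⟩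
        rw [List.isChain_cons_cons]
        exact ⟨(hPo z (by simp)).symm, hP.2⟩

theorem exists_isFrobenius (hGalois : π.IsGalois) (p : X.Prime) : ∃ g, π.IsFrobenius p g := by
  obtain ⟨l, rfl⟩ := p.exists_toPrime
  have hne := l.2.ne_nil
  obtain ⟨w, hw⟩ := π.surjective (X.origin (l.1.head hne))
  obtain ⟨P, hP, hPm, hPo⟩ := exists_lift_path (π := π) l.2.1.1 w (by
    intro a ha
    rw [List.head?_eq_some_head hne, Option.mem_some_iff] at ha
    rw [← ha, hw])
  have h1 : P.head hP.1 ∈ P.head? := by simp [List.head?_eq_some_head hP.1]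
  have h2 : P.getLast hP.1 ∈ P.getLast? := by simp [List.getLast?_eq_some_getLast hP.1]
  obtain ⟨g, hg⟩ := hGalois (Y.origin (P.head hP.1)) (Y.terminus (P.getLast hP.1)) (by
    rw [← π.origin_onE, ← π.terminus_onE]
    refine (l.2.1.2 _ ?_ _ ?_).symm
    · rw [← hPm, List.getLast?_map]
      exact Option.mem_map_of_mem _ h2
    · rw [← hPm, List.head?_map]
      exact Option.mem_map_of_mem _ h1)
  exact ⟨g, l, P, rfl, hP, hPm, _, h1, _, h2, hg⟩

/-- The Frobenius automorphism of a prime is the product of the voltages along it; as the values of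
characters commute, the choices of the path and of its lift do not matter. -/
theorem character_frob (hGalois : π.IsGalois) (χ : π.Aut →* ℂˣ)
    (l : {l : List EX // X.IsPrimePath l}) :
    (χ (π.frob (X.toPrime l)) : ℂ) = (l.1.map fun e => (χ (ω.volt e) : ℂ)).prod := by
  have hex := exists_isFrobenius hGalois (X.toPrime l)
  have hf : π.IsFrobenius (X.toPrime l) (π.frob (X.toPrime l)) := by
    rw [frob, dif_pos hex]
    exact hex.choose_spec
  obtain ⟨l', P, hl', hP, hPm, a, ha, b, hb, hg⟩ := hf
  have h := ω.coord_terminus_getLast hP a ha b hb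
  rw [← hg, ω.coord_smul, hPm] at h
  have h' := congrArg χ h
  rw [map_mul, map_mul, mul_comm, mul_left_cancel_iff, map_list_prod, List.map_map] at h'
  rw [h', ((toPrime_eq_iff.1 hl').perm.map _).prod_eq,
    ← Units.coeHom_apply, map_list_prod, List.map_map]
  rfl

end Voltage

end Cover

end Multigraph

/-! ### Laplacians with coefficients -/

namespace Multigraph

variable {V E : Type*} {X : Multigraph V E}

/-- The reversal of oriented edges as a permutation. -/
def reverse (X : Multigraph V E) : Equiv.Perm E := ⟨X.inv, X.inv, X.inv_inv, X.inv_inv⟩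

theorem sum_inv {M : Type*} [AddCommMonoid M] [Fintype E] (f : E → M) :
    ∑ e, f (X.inv e) = ∑ e, f e :=
  Equiv.sum_comp X.reverse f

theorem origin_inv (e : E) : X.origin (X.inv e) = X.terminus e := rfl

theorem terminus_inv (e : E) : X.terminus (X.inv e) = X.origin e := by
  rw [terminus, X.inv_inv]

theorem adjMatrix_transpose {A : Type*} [AddCommMonoid A] [Fintype E] [DecidableEq V] (c : E → A) :
    (X.adjMatrix c).transpose = X.adjMatrix fun e => c (X.inv e) := by
  ext v w
  simp only [Matrix.transpose_apply, adjMatrix, Matrix.of_apply]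
  rw [← sum_inv (X := X)]
  simp only [origin_inv, terminus_inv, and_comm]

/-- The Laplacian of `X` with coefficients `c`, i.e. valencies minus the weighted adjacency
matrix. A loop at `v` contributes `2 - c(e) - c(e⁻¹)` to the diagonal entry. -/
noncomputable def laplacian {R : Type*} [Ring R] [Fintype E] [DecidableEq V] (X : Multigraph V E)
    (c : E → R) : Matrix V V R :=
  Matrix.diagonal (fun v => (X.degree v : R)) - X.adjMatrix c

theorem laplacian_map {R S : Type*} [Ring R] [Ring S] [Fintype E] [DecidableEq V] (c : E → R)
    (f : R →+* S) : (X.laplacian c).map f = X.laplacian fun e => f (c e) := by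
  ext v w
  by_cases h : v = w
  · subst h
    simp [laplacian, adjMatrix, apply_ite f, map_sum]
  · simp [laplacian, adjMatrix, apply_ite f, map_sum, h]

theorem laplacian_transpose {R : Type*} [Ring R] [Fintype E] [DecidableEq V] (c : E → R) :
    (X.laplacian c).transpose = X.laplacian fun e => c (X.inv e) := by
  rw [laplacian, Matrix.transpose_sub, adjMatrix_transpose, Matrix.diagonal_transpose, laplacian]

theorem sum_adjMatrix_smul {R M : Type*} [Ring R] [AddCommGroup M] [Module R M] [Fintype V]
    [Fintype E] [DecidableEq V] (c : E → R) (f : V → M) (v : V) :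
    ∑ w, X.adjMatrix c v w • f w =
      ∑ e, if X.origin e = v then c e • f (X.terminus e) else 0 := by
  simp only [adjMatrix, Matrix.of_apply, Finset.sum_smul]
  rw [Finset.sum_comm]
  refine Finset.sum_congr rfl fun e _ => ?_
  rw [Finset.sum_eq_single (X.terminus e)]
  · by_cases h : X.origin e = v <;> simp [h]
  · intro x _ hx
    simp [hx.symm]
  · simp

theorem sum_laplacian_smul {R M : Type*} [Ring R] [AddCommGroup M] [Module R M] [Fintype V]
    [Fintype E] [DecidableEq V] (c : E → R) (f : V → M) (v : V) :
    ∑ w, X.laplacian c v w • f w =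
      ∑ e, if X.origin e = v then f v - c e • f (X.terminus e) else 0 := by
  have h1 : ∀ e, (if X.origin e = v then f v - c e • f (X.terminus e) else 0) =
      (if X.origin e = v then (1 : ℕ) else 0) • f v -
        if X.origin e = v then c e • f (X.terminus e) else 0 := by
    intro e
    split_ifs <;> simp
  simp only [laplacian, Matrix.sub_apply, sub_smul, Finset.sum_sub_distrib, sum_adjMatrix_smul, h1,
    ← Finset.sum_smul]
  congr 1
  rw [Finset.sum_eq_single v]
  · have : (∑ e, if X.origin e = v then (1 : ℕ) else 0) = X.degree v := by
      rw [degree, Nat.card_eq_fintype_card, Fintype.card_subtype, Finset.sum_boole, Nat.cast_id]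
    rw [this, Matrix.diagonal_apply_eq, Nat.cast_smul_eq_nsmul]
  · intro w _ hw
    rw [Matrix.diagonal_apply_ne _ hw.symm, zero_smul]
  · simp

/-- A function killed by a unitary twisted Laplacian is parallel along every edge, because its
energy `∑ |f(o(e)) - c(e) f(t(e))|²` vanishes. -/
theorem eq_of_laplacian_mulVec_eq_zero [Fintype V] [Fintype E] [DecidableEq V] {c : E → ℂ}
    (hc : ∀ e, c e * c (X.inv e) = 1) (hstar : ∀ e, starRingEnd ℂ (c e) = c (X.inv e)) {f : V → ℂ}
    (hf : (X.laplacian c).mulVec f = 0) (e : E) : f (X.origin e) = c e * f (X.terminus e) := by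
  have hf' : ∀ v, ∑ e, (if X.origin e = v then f v - c e * f (X.terminus e) else 0) = 0 := by
    intro v
    exact (sum_laplacian_smul (X := X) c f v).symm.trans (congrFun hf v)
  have S1 : ∑ e, starRingEnd ℂ (f (X.origin e)) *
      (f (X.origin e) - c e * f (X.terminus e)) = 0 := by
    have h : ∀ e, starRingEnd ℂ (f (X.origin e)) * (f (X.origin e) - c e * f (X.terminus e)) =
        ∑ v, starRingEnd ℂ (f v) *
          (if X.origin e = v then f v - c e * f (X.terminus e) else 0) := by
      intro e
      rw [Finset.sum_eq_single (X.origin e)]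
      · simp
      · intro v _ hv
        simp [hv.symm]
      · simp
    simp only [h]
    rw [Finset.sum_comm]
    refine Finset.sum_eq_zero fun v _ => ?_
    rw [← Finset.mul_sum, hf', mul_zero]
  have S2 := S1
  rw [← sum_inv (X := X)] at S2
  have hsum : ∑ e, (Complex.normSq (f (X.origin e) - c e * f (X.terminus e)) : ℂ) = 0 := by
    rw [← add_zero (0 : ℂ)]
    nth_rewrite 1 [← S1]
    rw [← S2, ← Finset.sum_add_distrib]
    refine Finset.sum_congr rfl fun e _ => ?_
    rw [← Complex.mul_conj, map_sub, map_mul, hstar, origin_inv, terminus_inv]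
    linear_combination f (X.terminus e) * starRingEnd ℂ (f (X.terminus e)) * hc e
  have hsum' : ∑ e, Complex.normSq (f (X.origin e) - c e * f (X.terminus e)) = 0 := by
    exact_mod_cast hsum
  rw [Finset.sum_eq_zero_iff_of_nonneg fun _ _ => Complex.normSq_nonneg _] at hsum'
  exact sub_eq_zero.1 (Complex.normSq_eq_zero.1 (hsum' e (Finset.mem_univ e)))

theorem det_laplacian_one [Fintype V] [Fintype E] [DecidableEq V] [Nonempty V] :
    (X.laplacian fun _ => (1 : ℂ)).det = 0 := by
  rw [← Matrix.exists_mulVec_eq_zero_iff]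
  refine ⟨fun _ => 1, fun h => one_ne_zero (congrFun h (Classical.arbitrary V)), ?_⟩
  funext v
  refine (sum_laplacian_smul (X := X) (fun _ => (1 : ℂ)) (fun _ => (1 : ℂ)) v).trans ?_
  simp

theorem div_single [DecidableEq V] [Fintype V] [Fintype E] (v : V) :
    X.div (Pi.single v 1) = ∑ e, if X.origin e = v then
      Finsupp.single v 1 - Finsupp.single (X.terminus e) 1 else 0 := by
  have h := sum_laplacian_smul (X := X) (fun _ => (1 : ℤ))
    (fun w => (Finsupp.single w 1 : V →₀ ℤ)) v
  simp only [one_smul] at h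
  rw [← h]
  simp only [div, LinearMap.coe_mk, AddHom.coe_mk]
  rw [Finset.sum_eq_single v]
  · rw [Pi.single_eq_same, one_smul]
    refine Finset.sum_congr rfl fun w _ => ?_
    rw [Finsupp.smul_single, smul_eq_mul, mul_one]
    congr 1
    have h1 : ((X.adjMatrix fun _ => (1 : ℤ)) v w) = X.numEdges v w := by
      rw [numEdges, Nat.card_eq_fintype_card, Fintype.card_subtype, adjMatrix, Matrix.of_apply,
        Finset.sum_boole]
    have h2 : X.numEdges w v = X.numEdges v w := by
      refine Nat.card_congr (X.reverse.subtypeEquiv fun e => ?_)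
      change _ ↔ X.origin (X.inv e) = v ∧ X.terminus (X.inv e) = w
      rw [origin_inv, terminus_inv, and_comm]
    rw [rho, laplacian, Matrix.sub_apply, h1, h2]
    by_cases hvw : w = v
    · subst hvw
      simp
    · rw [if_neg hvw, Matrix.diagonal_apply_ne _ (Ne.symm hvw), zero_sub]
  · intro w _ hw
    simp [hw]
  · simp

namespace Cover

variable {VX EX VY EY : Type*} {X : Multigraph VX EX} {Y : Multigraph VY EY} {π : Cover Y X}

/-- The oriented edges of `Y` starting at `w` correspond to those of `X` starting at `π(w)`. -/
theorem sum_lift [Fintype EX] [Fintype EY] [DecidableEq VX] [DecidableEq VY] {M : Type*}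
    [AddCommMonoid M] (w : VY) (F : EX → M) :
    (∑ e', if Y.origin e' = w then F (π.onE e') else 0) =
      ∑ e, if X.origin e = π.onV w then F e else 0 := by
  rw [← Finset.sum_filter, ← Finset.sum_filter]
  refine Finset.sum_bij (fun e' _ => π.onE e') ?_ ?_ ?_ ?_
  · intro e' he'
    simp only [Finset.mem_filter, Finset.mem_univ, true_and] at he' ⊢
    rw [π.origin_onE, he']
  · intro e₁ h₁ e₂ h₂ h
    simp only [Finset.mem_filter, Finset.mem_univ, true_and] at h₁ h₂
    exact π.eq_of_origin_eq_of_onE_eq (h₁.trans h₂.symm) h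
  · intro e he
    simp only [Finset.mem_filter, Finset.mem_univ, true_and] at he
    obtain ⟨e', he', rfl⟩ := (π.lift w e he).exists
    exact ⟨e', by simpa using he', rfl⟩
  · intro _ _
    rfl

namespace Voltage

variable (ω : π.Voltage)

theorem character_volt_inv (χ : π.Aut →* ℂˣ) (e : EX) :
    (χ (ω.volt e) : ℂ) * χ (ω.volt (X.inv e)) = 1 := by
  rw [← Units.val_mul, ← map_mul, ω.volt_mul_volt_inv, map_one, Units.val_one]

/-- A function killed by the Laplacian lifts to a function on `Y` which is constant and transforms
under `G` by `χ`; it is zero if `χ ≠ 1`. -/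
theorem det_laplacian_ne_zero [Fintype VX] [Fintype EX] [DecidableEq VX] [Finite π.Aut]
    (hY : Y.Connected) {χ : π.Aut →* ℂˣ} (hχ : χ ≠ 1) :
    (X.laplacian fun e => (χ (ω.volt e) : ℂ)).det ≠ 0 := by
  intro h0
  obtain ⟨f, hf0, hf⟩ := Matrix.exists_mulVec_eq_zero_iff.2 h0
  have hharm := eq_of_laplacian_mulVec_eq_zero (ω.character_volt_inv χ) (fun e => by
    rw [star_character_apply, MonoidHom.inv_apply, Units.val_inv_eq_inv_val]
    exact inv_eq_of_mul_eq_one_right (ω.character_volt_inv χ e)) hf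
  obtain ⟨v, hv⟩ := Function.ne_iff.1 hf0
  let F : VY → ℂ := fun w => χ (ω.coord w) * f (π.onV w)
  have hF : ∀ w, F w = F (ω.sec v) := by
    intro w
    induction hY.2 (ω.sec v) w with
    | refl => rfl
    | tail _ h ih =>
      obtain ⟨e, rfl, rfl⟩ := h
      rw [← ih]
      have := hharm (π.onE e)
      rw [π.origin_onE, π.terminus_onE] at this
      simp only [F, this, ω.coord_terminus, map_mul, Units.val_mul, mul_assoc]
  apply hχ
  ext g
  have := hF (g • ω.sec v)
  simp only [F, ω.coord_smul, ω.coord_sec, onV_smul, ω.onV_sec, mul_one, map_one, Units.val_one,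
    one_mul] at this
  simpa using mul_right_cancel₀ hv (this.trans (one_mul _).symm)

end Voltage

end Cover

end Multigraph

/-! ### The special value and the Picard group -/

namespace Multigraph

namespace Cover

variable {VX EX VY EY : Type*} {X : Multigraph VX EX} {Y : Multigraph VY EY} {π : Cover Y X}

theorem of_smul_single (g : π.Aut) (w : VY) :
    MonoidAlgebra.of ℤ π.Aut g • (π.divRep.asModuleEquiv.symm (Finsupp.single w 1)) =
      π.divRep.asModuleEquiv.symm (Finsupp.single (g • w) 1) := by
  apply π.divRep.asModuleEquiv.injective
  rw [Representation.asModuleEquiv_map_smul, Representation.asAlgebraHom_of,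
    LinearEquiv.apply_symm_apply, LinearEquiv.apply_symm_apply]
  exact Finsupp.mapDomain_single

namespace Voltage

variable (ω : π.Voltage)

/-- The combination of the vertices `sec w` given by the row `v` of the Laplacian over `ℤ[G]` is
the principal divisor of the vertex `sec v`. -/
theorem sum_laplacian_smul_mem_principal [Fintype VX] [Fintype EX] [DecidableEq VX] [Fintype VY]
    [Fintype EY] [DecidableEq VY] (v : VX) :
    ∑ w, X.laplacian (fun e => MonoidAlgebra.of ℤ π.Aut (ω.volt e)) v w •
      (π.divRep.asModuleEquiv.symm (Finsupp.single (ω.sec w) 1)) ∈ π.principal := by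
  rw [sum_laplacian_smul (X := X)]
  have h : Y.div (Pi.single (ω.sec v) 1) =
      π.divRep.asModuleEquiv (∑ e, if X.origin e = v then
        (π.divRep.asModuleEquiv.symm (Finsupp.single (ω.sec v) 1)) -
          MonoidAlgebra.of ℤ π.Aut (ω.volt e) •
            (π.divRep.asModuleEquiv.symm (Finsupp.single (ω.sec (X.terminus e)) 1)) else 0) := by
    have hsum := sum_lift (π := π) (ω.sec v) fun e =>
      (π.divRep.asModuleEquiv.symm (Finsupp.single (ω.sec v) 1)) -
          MonoidAlgebra.of ℤ π.Aut (ω.volt e) •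
            (π.divRep.asModuleEquiv.symm (Finsupp.single (ω.sec (X.terminus e)) 1))
    rw [ω.onV_sec] at hsum
    rw [← hsum, div_single, map_sum]
    refine Finset.sum_congr rfl fun e _ => ?_
    split_ifs with he
    · have hvolt : ω.volt (π.onE e) • ω.sec (X.terminus (π.onE e)) = Y.terminus e := by
        have := ω.coord_terminus e
        rw [he, ω.coord_sec, one_mul] at this
        rw [← this, π.terminus_onE, ω.coord_smul_sec]
      rw [of_smul_single, hvolt, map_sub, LinearEquiv.apply_symm_apply,
        LinearEquiv.apply_symm_apply]
    · rw [map_zero]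
  exact ⟨_, h⟩

/-- Here `z` and `N` are the determinant and the adjugate of the Laplacian over `ℤ[G]`. -/
theorem smul_mem_principal [Fintype VX] [Fintype EX] [DecidableEq VX] [Fintype VY]
    [Fintype EY] [DecidableEq VY] {z : MonoidAlgebra ℤ π.Aut}
    (hcomm : ∀ a b : MonoidAlgebra ℤ π.Aut, a * b = b * a)
    {N : Matrix VX VX (MonoidAlgebra ℤ π.Aut)}
    (hN : ∀ v w, (N * X.laplacian (fun e => MonoidAlgebra.of ℤ π.Aut (ω.volt e))) v w =
      if v = w then z else 0) (D : π.DivMod) : z • D ∈ π.principal := by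
  set S : VX → π.DivMod := fun w => π.divRep.asModuleEquiv.symm (Finsupp.single (ω.sec w) 1)
    with hS
  have h1 : ∀ v, z • S v ∈ π.principal := by
    intro v
    have : z • S v = ∑ u, N v u •
        ∑ w, X.laplacian (fun e => MonoidAlgebra.of ℤ π.Aut (ω.volt e)) u w • S w := by
      simp only [Finset.smul_sum, smul_smul]
      rw [Finset.sum_comm]
      simp only [← Finset.sum_smul, ← Matrix.mul_apply, hN]
      rw [Finset.sum_eq_single v]
      · simp
      · intro w _ hw
        rw [if_neg hw.symm, zero_smul]
      · simp
    rw [this]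
    exact Submodule.sum_mem _ fun u _ =>
      Submodule.smul_mem _ _ (ω.sum_laplacian_smul_mem_principal u)
  have h2 : ∀ w : VY, z • π.divRep.asModuleEquiv.symm (Finsupp.single w 1) ∈ π.principal := by
    intro w
    have e := of_smul_single (ω.coord w) (ω.sec (π.onV w))
    rw [ω.coord_smul_sec] at e
    rw [← e, smul_smul, hcomm, ← smul_smul]
    exact Submodule.smul_mem _ _ (h1 _)
  obtain ⟨f, rfl⟩ := π.divRep.asModuleEquiv.symm.surjective D
  induction f using Finsupp.induction_linear with
  | zero => simp
  | add f g hf hg =>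
    rw [map_add, smul_add]
    exact Submodule.add_mem _ hf hg
  | single w n =>
    have : (Finsupp.single w n : VY →₀ ℤ) = n • Finsupp.single w 1 := by simp
    rw [this, map_smul, smul_comm]
    exact zsmul_mem (h2 w) n

end Voltage

theorem mem_annihilator_of_smul_mem [Fintype VY] [DecidableEq VY] [Fintype EY]
    {z : MonoidAlgebra ℤ π.Aut} (hz : ∀ D : π.DivMod, z • D ∈ π.principal) :
    z ∈ Module.annihilator (MonoidAlgebra ℤ π.Aut) π.Jac ∧
      z ∈ Module.annihilator (MonoidAlgebra ℤ π.Aut) π.Pic := by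
  constructor
  · rw [Module.mem_annihilator]
    intro x
    obtain ⟨D, rfl⟩ := Submodule.mkQ_surjective _ x
    rw [← map_smul, Submodule.mkQ_apply, Submodule.Quotient.mk_eq_zero]
    exact hz D
  · rw [Module.mem_annihilator]
    intro x
    obtain ⟨D, rfl⟩ := Submodule.mkQ_surjective _ x
    rw [← map_smul, Submodule.mkQ_apply, Submodule.Quotient.mk_eq_zero]
    exact hz D

open scoped PowerSeries.WithPiTopology in
theorem Voltage.hasProd_eulerFactor [Fintype EX] [DecidableEq EX] (ω : π.Voltage)
    (hGalois : π.IsGalois) (χ : π.Aut →* ℂˣ) :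
    HasProd (π.eulerFactor χ)
      ((((X.edgeMatrix fun e => (χ (ω.volt e) : ℂ)).charpolyRev : ℂ[X]) : ℂ⟦X⟧)⁻¹) :=
  hasProd_eulerFactor_charpolyRev_inv _ (fun p => (χ (π.frob p) : ℂ)) Prime.length
    Prime.length_pos finite_primes_length_le
    fun _ s hm hs => trace_edgeMatrix_pow (ω.character_frob hGalois χ) hm s hs

open scoped PowerSeries.WithPiTopology in
theorem Voltage.lConverges [Fintype EX] (ω : π.Voltage) (hGalois : π.IsGalois)
    (χ : π.Aut →* ℂˣ) : π.LConverges χ := by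
  classical
  exact (ω.hasProd_eulerFactor hGalois χ).multipliable

open scoped PowerSeries.WithPiTopology in
theorem Voltage.coe_charpolyRev_eq_inv_L [Fintype EX] [DecidableEq EX] (ω : π.Voltage)
    (hGalois : π.IsGalois) (χ : π.Aut →* ℂˣ) :
    (((X.edgeMatrix fun e => (χ (ω.volt e) : ℂ)).charpolyRev : ℂ[X]) : ℂ⟦X⟧) = (π.L χ)⁻¹ := by
  have h0 : PowerSeries.constantCoeff
      (((X.edgeMatrix fun e => (χ (ω.volt e) : ℂ)).charpolyRev : ℂ[X]) : ℂ⟦X⟧) ≠ 0 := by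
    simp [Polynomial.coeff_zero_eq_eval_zero]
  rw [L, (ω.hasProd_eulerFactor hGalois χ).tprod_eq, PowerSeries.eq_inv_iff_mul_eq_one,
    PowerSeries.mul_inv_cancel _ h0]
  simp [Polynomial.coeff_zero_eq_eval_zero]

theorem conjChar_eq [Finite π.Aut] (χ : π.Aut →* ℂˣ) :
    π.conjChar χ = (Units.coeHom ℂ).comp χ⁻¹ := by
  ext σ
  exact star_character_apply χ σ

end Cover

section Point

variable {V E : Type*} {X : Multigraph V E}

theorem isEmpty_edges_of_degree_eq_zero (hX : X.Connected) [Finite E] {v : V}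
    (hv : X.degree v = 0) : IsEmpty E := by
  have h0 : ∀ e, X.origin e ≠ v := by
    intro e he
    have : IsEmpty {e : E // X.origin e = v} := by
      rcases Nat.card_eq_zero.1 hv with h | h
      · exact h
      · exact absurd h (not_infinite_iff_finite.2 inferInstance)
    exact this.false ⟨e, he⟩
  have h1 : ∀ w, v = w := by
    intro w
    rcases Relation.ReflTransGen.cases_head (hX.2 v w) with h | ⟨_, ⟨e, he, -⟩, -⟩
    · exact h
    · exact absurd he (h0 e)
  exact ⟨fun e => h0 e (h1 _).symm⟩

/-- Since `E` consists of oriented edges, the first alternative says that there are at least as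
many edges as vertices; the second one means that `X` is a point. -/
theorem card_vertices_le_or_isEmpty (hX : X.Connected) (hdeg : ∀ v, X.degree v ≠ 1) [Fintype V]
    [Fintype E] : 2 * Fintype.card V ≤ Fintype.card E ∨ IsEmpty E := by
  classical
  by_cases h : ∃ v, X.degree v = 0
  · obtain ⟨v, hv⟩ := h
    exact Or.inr (isEmpty_edges_of_degree_eq_zero hX hv)
  · left
    push Not at h
    have hsum : ∑ v, X.degree v = Fintype.card E := by
      rw [← Fintype.card_congr (Equiv.sigmaFiberEquiv X.origin), Fintype.card_sigma]
      refine Finset.sum_congr rfl fun v _ => ?_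
      rw [degree, Nat.card_eq_fintype_card]
    rw [← hsum, mul_comm, ← smul_eq_mul, ← Finset.card_univ]
    refine Finset.card_nsmul_le_sum _ _ _ fun v _ => ?_
    have := h v
    have := hdeg v
    omega

theorem Cover.subsingleton_aut {VY EY : Type*} {Y : Multigraph VY EY} (π : Cover Y X)
    (hY : Y.Connected) [IsEmpty E] : Subsingleton π.Aut := by
  have : IsEmpty EY := ⟨fun e => IsEmpty.false (π.onE e)⟩
  have hsub : ∀ w w' : VY, w = w' := by
    intro w w'
    rcases Relation.ReflTransGen.cases_head (hY.2 w w') with h | ⟨_, ⟨e, -⟩, -⟩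
    · exact h
    · exact isEmptyElim e
  obtain ⟨w⟩ := hY.1
  exact ⟨fun g h => Cover.eq_of_smul_eq_smul hY (w := w) (hsub _ _)⟩

end Point

theorem leadingCoeffAtOne_pow_mul {k : ℕ} {H : ℂ[X]} (hH : H.eval 1 ≠ 0) :
    Cover.leadingCoeffAtOne ((1 - Polynomial.X ^ 2) ^ k * H) = (-2) ^ k * H.eval 1 := by
  have h1 : Polynomial.taylor 1 (1 - Polynomial.X ^ 2 : ℂ[X]) =
      Polynomial.X * (-Polynomial.X - Polynomial.C 2) := by
    rw [map_sub, Polynomial.taylor_one, Polynomial.taylor_X_pow]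
    simp only [map_one, Polynomial.C_ofNat]
    ring
  have h2 : (-Polynomial.X - Polynomial.C 2 : ℂ[X]).trailingCoeff = -2 := by
    rw [Polynomial.trailingCoeff_eq_coeff_zero] <;> simp
  have hX : (Polynomial.X : ℂ[X]).trailingCoeff = 1 := by
    simp [Polynomial.trailingCoeff]
  have h3 : (Polynomial.taylor 1 H).trailingCoeff = H.eval 1 := by
    rw [Polynomial.trailingCoeff_eq_coeff_zero] <;> simp [hH]
  have hpow : ∀ p : ℂ[X], (p ^ k).trailingCoeff = p.trailingCoeff ^ k := by
    intro p
    induction k with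
    | zero => rw [pow_zero, pow_zero, Polynomial.trailingCoeff_eq_coeff_zero] <;> simp
    | succ k ih => rw [pow_succ, Polynomial.trailingCoeff_mul, ih, pow_succ]
  rw [Cover.leadingCoeffAtOne, Polynomial.taylor_mul, Polynomial.taylor_pow,
    Polynomial.trailingCoeff_mul, h3, hpow, h1, Polynomial.trailingCoeff_mul, h2,
    hX, one_mul]

/-- The first nonvanishing Taylor coefficient at `u = 1` of `det (1 - uW)`; here `k` is the number
of edges minus the number of vertices, and the factor `-2` comes from
`1 - u² = (u - 1)(-(u - 1) - 2)`. -/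
theorem exists_leadingCoeffAtOne_charpolyRev {V E : Type*} {X : Multigraph V E} [Fintype V]
    [Fintype E] [DecidableEq V] [DecidableEq E] (hcard : 2 * Fintype.card V ≤ Fintype.card E) :
    ∃ k : ℕ, ∀ c : E → ℂ, (∀ e, c e * c (X.inv e) = 1) → (X.laplacian c).det ≠ 0 →
      Cover.leadingCoeffAtOne (X.edgeMatrix c).charpolyRev = (-2) ^ k * (X.laplacian c).det := by
  obtain ⟨m, hm, hIB⟩ := X.ihara_bass
  obtain ⟨k, rfl⟩ : ∃ k, m = Fintype.card V + k := Nat.exists_eq_add_of_le (by omega)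
  refine ⟨k, fun c hc hdet => ?_⟩
  have hq : (1 - Polynomial.X ^ 2 : ℂ[X]) ≠ 0 := by
    intro h
    have := congrArg (Polynomial.eval 0) h
    simp at this
  have h := hIB (fun e => Polynomial.C (c e)) (fun e => by rw [← map_mul, hc, map_one])
    Polynomial.X hq
  rw [pow_add, mul_assoc] at h
  have h' := mul_left_cancel₀ (pow_ne_zero _ hq) h
  have hmap : X.edgeMatrix (fun e => Polynomial.C (c e)) = (X.edgeMatrix c).map Polynomial.C := by
    ext a b : 1
    simp [edgeMatrix, apply_ite Polynomial.C]
  rw [hmap] at h'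
  set H := ((1 - Polynomial.X ^ 2 : ℂ[X]) • (1 : Matrix V V ℂ[X]) -
    (Polynomial.X : ℂ[X]) • X.adjMatrix (fun e => Polynomial.C (c e)) +
      (Polynomial.X ^ 2 : ℂ[X]) • Matrix.diagonal fun v => (X.degree v : ℂ[X])).det with hH
  have hev : H.eval 1 = (X.laplacian c).det := by
    rw [hH, ← Polynomial.coe_evalRingHom, RingHom.map_det]
    congr 1
    ext v w
    by_cases hvw : v = w
    · subst hvw
      simp [laplacian, adjMatrix, Polynomial.eval_finsetSum, apply_ite (Polynomial.eval (1 : ℂ))]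
      ring
    · simp [laplacian, adjMatrix, Polynomial.eval_finsetSum, apply_ite (Polynomial.eval (1 : ℂ)),
        hvw]
  rw [Matrix.charpolyRev, h', leadingCoeffAtOne_pow_mul (by rwa [hev]), hev]

end Multigraph

theorem mainTheorem1 {VX EX VY EY : Type*}
    [Fintype VX] [Fintype EX] [Fintype VY] [Fintype EY] [DecidableEq VY]
    (X : Multigraph VX EX) (Y : Multigraph VY EY)
    (hX : X.Connected) (hY : Y.Connected) (hdeg : ∀ v : VX, X.degree v ≠ 1)
    (π : Multigraph.Cover Y X) (hGalois : π.IsGalois)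
    (hab : ∀ g h : π.Aut, g * h = h * g) :
    (∀ χ : π.Aut →* ℂˣ, π.LConverges χ) ∧
    ∃ Linv : (π.Aut →* ℂˣ) → ℂ[X],
      (∀ χ : π.Aut →* ℂˣ, ((Linv χ : ℂ[X]) : ℂ⟦X⟧) = (π.L χ)⁻¹) ∧
      ∃ z : MonoidAlgebra ℤ π.Aut,
        MonoidAlgebra.mapRingHom π.Aut (Int.castRingHom ℂ) z =
          π.thetaStar Linv * (1 - π.idem (1 : π.Aut →* ℂ)) ∧
        z ∈ Module.annihilator (MonoidAlgebra ℤ π.Aut) π.Jac ∧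
        z ∈ Module.annihilator (MonoidAlgebra ℤ π.Aut) π.Pic := by
  classical
  obtain ⟨ω⟩ := π.exists_voltage hY hGalois
  set Linv : (π.Aut →* ℂˣ) → ℂ[X] := fun χ =>
    (X.edgeMatrix fun e => (χ (ω.volt e) : ℂ)).charpolyRev with hLinv
  refine ⟨ω.lConverges hGalois, Linv, ω.coe_charpolyRev_eq_inv_L hGalois, ?_⟩
  · -- By Fourier inversion it suffices to prescribe the values of `z` at all characters.
    suffices h : ∃ z : MonoidAlgebra ℤ π.Aut, (∀ D : π.DivMod, z • D ∈ π.principal) ∧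
        MonoidAlgebra.lift ℂ ℂ π.Aut (1 : π.Aut →* ℂ)
          (MonoidAlgebra.mapRingHom π.Aut (Int.castRingHom ℂ) z) = 0 ∧
        ∀ χ : π.Aut →* ℂˣ, χ ≠ 1 → MonoidAlgebra.lift ℂ ℂ π.Aut ((Units.coeHom ℂ).comp χ⁻¹)
          (MonoidAlgebra.mapRingHom π.Aut (Int.castRingHom ℂ) z) =
            Multigraph.Cover.leadingCoeffAtOne (Linv χ) by
      obtain ⟨z, hz, h1, hχ⟩ := h
      refine ⟨z, ?_, Multigraph.Cover.mem_annihilator_of_smul_mem hz⟩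
      rw [eq_finsum_charIdem_mul hab _ _ h1 hχ, Multigraph.Cover.thetaStar]
      simp only [Multigraph.Cover.conjChar_eq]
      rfl
    rcases Multigraph.card_vertices_le_or_isEmpty hX hdeg with hcard | hE
    · have hcomm : ∀ a b : MonoidAlgebra ℤ π.Aut, a * b = b * a := by
        let _ : CommGroup π.Aut := { (inferInstance : Group π.Aut) with mul_comm := hab }
        exact mul_comm
      obtain ⟨z₀, N, hN, hz₀⟩ := exists_adjugate_of_commute hcomm (X.laplacian fun e => MonoidAlgebra.of ℤ π.Aut (ω.volt e))
      obtain ⟨k, hk⟩ := Multigraph.exists_leadingCoeffAtOne_charpolyRev (X := X) hcard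
      have hval : ∀ χ : π.Aut →* ℂˣ, MonoidAlgebra.lift ℂ ℂ π.Aut ((Units.coeHom ℂ).comp χ)
          (MonoidAlgebra.mapRingHom π.Aut (Int.castRingHom ℂ) z₀) =
            (X.laplacian fun e => (χ (ω.volt e) : ℂ)).det := by
        intro χ
        have := hz₀ ((MonoidAlgebra.lift ℂ ℂ π.Aut ((Units.coeHom ℂ).comp χ)).toRingHom.comp
          (MonoidAlgebra.mapRingHom π.Aut (Int.castRingHom ℂ)))
        rw [Multigraph.laplacian_map] at this
        refine this.trans ?_
        congr 2
        funext e
        simp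
      refine ⟨(-2) ^ k * z₀, fun D => ?_, ?_, fun χ hχ => ?_⟩
      · rw [mul_smul]
        exact Submodule.smul_mem _ _ (ω.smul_mem_principal hcomm hN D)
      · have e1 : (Units.coeHom ℂ).comp (1 : π.Aut →* ℂˣ) = 1 := by ext; simp
        have := hX.1
        have h := hval 1
        simp only [MonoidHom.one_apply, Units.val_one, Multigraph.det_laplacian_one, e1] at h
        rw [map_mul, map_mul, h, mul_zero]
      · have hinv : (X.laplacian fun e => ((χ⁻¹ (ω.volt e) : ℂˣ) : ℂ)).det =
            (X.laplacian fun e => (χ (ω.volt e) : ℂ)).det := by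
          rw [← Matrix.det_transpose, Multigraph.laplacian_transpose]
          congr 2
          funext e
          rw [MonoidHom.inv_apply, Units.val_inv_eq_inv_val]
          exact inv_eq_of_mul_eq_one_left (ω.character_volt_inv χ e)
        rw [map_mul, map_mul, hval, hinv, hLinv,
          hk _ (ω.character_volt_inv χ) (ω.det_laplacian_ne_zero hY hχ), map_pow, map_pow,
          map_neg, map_neg, map_ofNat, map_ofNat]
    · -- If `X` is a point then `G` is trivial and there is no nontrivial character.
      have := π.subsingleton_aut hY
      refine ⟨0, fun D => by simp, by simp, fun χ hχ => ?_⟩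
      exact absurd (MonoidHom.ext fun g => by rw [Subsingleton.elim g 1, map_one, map_one]) hχ
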